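/- **Setting.** Let $Q$ be a finite quiver, $K$ a field, $\mathcal P=KQ$ its path algebra (monomials = paths, $\deg$ = length; products of non-composable paths are $0$; $1_v$ is the trivial path at the vertex $v$). Let $\psi:\mathcal P\to\mathcal A$ be a surjective homomorphism of $K$-algebras with $\dim_K\mathcal A<\infty$, such that every element of $\ker\psi$ is a linear combination of paths of length at least $2$. Let $>$ be a monomial ordering on $\mathcal P$: a total ordering of the paths such that $b_1>b_2$ implies $b_1b>b_2b$ and $b'b_1>b'b_2$ whenever both products compared are non-zero. A path is *standard* if it is not the leading monomial (LM) of an element of $\ker\psi$. The monomials of $\mathcal A$ are the images $b=\psi(\lambda(b))$ of the standard paths $\lambda(b)$, ordered as the $\lambda(b)$. Assume that $\psi(p)=0$ for all sufficiently long paths $p$, or that $>$ is a well-ordering (well-founded), or else at least that the monomials of $\mathcal A$ span $\mathcal A$; in each case they form a $K$-basis of $\mathcal A$. For monomials $b,c$ of $\mathcal A$, call $c$ a *small cofactor* of $b$ if $\lambda(b)\lambda(c)$ is non-zero and standard (then $bc$ is a monomial, with $\lambda(bc)=\lambda(b)\lambda(c)$). Call $c$ the *cofactor of a minimal toppling* of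 $b$ if $c$ is not a small cofactor of $b$, but every monomial $c'\neq c$ for which $\lambda(c')$ is an initial subpath of $\lambda(c)$ is one. Let $F=\mathcal A^r$ be the free right module with generators $\mathfrak v_i$ and monomials $\mathfrak v_i b$. Fix a total ordering on its monomials with: $b_1>b_2\Rightarrow \mathfrak v_ib_1>\mathfrak v_ib_2$; and $\mathfrak v_ib_1>\mathfrak v_jb_2\Rightarrow \mathfrak v_ib_1b>\mathfrak v_j\mathrm{LM}(b_2b)$ or $b_2b=0$, whenever $b$ is a small cofactor of $b_1$. If $\mathrm{LM}(f)=\mathfrak v_ib$, a small cofactor of $\mathrm{LM}(f)$ means one of $b$. Let $E=\mathcal P^m$ be the free right $\mathcal P$-module with generators $\mathfrak e_i$ and monomials $\mathfrak e_ip$ ($p$ a path). Fix a total ordering on these with $p_1>p_2\Rightarrow\mathfrak e_ip_1>\mathfrak e_ip_2$, and $s_1>s_2\Rightarrow s_1b>s_2b$ whenever both products with the path $b$ are non-zero. Let $\hat g_1,\dots,\hat g_m\in F$, generating a submodule $M$. Below, $g=(\mathrm{poly}(g),\sigma(g))$ denotes a pair of an element of $F$ and a monomial of $E$ (its signature), $\mathrm{LM}(g)=\mathrm{LM}(\mathrm{poly}(g))$,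 $\mathrm{LC}$ is the leading coefficient, $G$ is a finite set of such pairs, $L$ a finite set of monomials of $E$; every inequality or equation between products $\sigma(g)\lambda(c)$ and monomials includes that the product is non-zero. * $f\in F$ is *$s$-reducible* w.r.t. $G$ if there are $g\in G$ and a small cofactor $c$ of $\mathrm{LM}(g)$ with $\mathrm{LM}(g)c=\mathrm{LM}(f)$ and $\sigma(g)\lambda(c)<s$. A *reduction step* replaces $f$ by $f-\frac{\mathrm{LC}(f)}{\mathrm{LC}(g)}\mathrm{poly}(g)c$ for such $g,c$. $\mathrm{NF}_s(f,G)$ is computed by reduction steps until none is possible. A pair $g$ is reducible if $\mathrm{poly}(g)$ is $\sigma(g)$-reducible. * $G$ is *interreduced* if no $g\in G$ is reducible w.r.t. $G$, and there are no $g'\ne g$ in $G$ and small cofactor $c$ of $\mathrm{LM}(g')$ with $\mathrm{LM}(g')c=\mathrm{LM}(g)$ and $\sigma(g')\lambda(c)=\sigma(g)$. *Interreducing* $G$: as long as possible, either choose $g\in G$ that is reducible w.r.t. $G\setminus\{g\}$ and replace $\mathrm{poly}(g)$ by its normal form w.r.t. $G\setminus\{g\}$ and $\sigma(g)$ — if this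 is $0$, delete $g$ from $G$ and add $\sigma(g)$ to $L$ —, or delete a $g\in G$ for which $g',c$ as above exist. * A *critical pair* of $G$ of type T is $(g,c)$ with $g\in G$ and $c$ the cofactor of a minimal toppling of $\mathrm{LM}(g)$; its S-polynomial is $\mathcal S=(\mathrm{poly}(g)c,\ \sigma(g)\lambda(c))$. One of type S is $(g,g')$ with $g,g'\in G$, $\mathrm{LM}(g')=\mathrm{LM}(g)c$ for a small cofactor $c$ of $\mathrm{LM}(g)$, and $\sigma(g')<\sigma(g)\lambda(c)$; its S-polynomial is $\mathcal S=(\mathrm{poly}(g)c-\frac{\mathrm{LC}(g)}{\mathrm{LC}(g')}\mathrm{poly}(g'),\ \sigma(g)\lambda(c))$. It is *normal relative to $L$* if $g$ (resp. $g$ and $g'$) is not reducible w.r.t. $G$, and $\sigma(g)\lambda(c)=\mathfrak e_ip\ne0$ where $p$ is standard and there are no paths $c',b,d$ with $\mathfrak e_ic'\in L$ and $p=bc'd$. **The $F_5$ algorithm.** Start with $G$ obtained by interreducing the set of all $(\hat g_i1_v,\ \mathfrak e_i1_v)$ ($1\le i\le m$, $v$ a vertex) with $\hat g_i1_v\neq0$,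 and $L=\emptyset$. While there is a critical pair $p$ of $G$, normal relative to $L$, for which there are no $g\in G$ and small cofactor $c$ of $\mathrm{LM}(g)$ with $\sigma(g)\lambda(c)=\sigma(\mathcal S(p))$ and $\mathrm{poly}(g)c$ not $\sigma(\mathcal S(p))$-reducible w.r.t. $G$: choose such a $p$, compute the normal form $f$ of $\mathrm{poly}(\mathcal S(p))$ w.r.t. $G$ and $\sigma(\mathcal S(p))$; if $f=0$, add $\sigma(\mathcal S(p))$ to $L$; otherwise add $(f,\sigma(\mathcal S(p)))$ to $G$ and interreduce $G$. When there is no such $p$, return $G$. **Lemma.** The $F_5$ algorithm terminates: whatever choices are made (of critical pairs, of reduction steps, and in the interreductions), there is no infinite sequence of elementary steps, and every run that cannot be continued has reached the return statement. -/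

import Mathlib

universe u₁ u₂ u₃ u₄

noncomputable section

namespace F5

/-! ### Paths in a quiver and the path algebra -/

/-- A path in a quiver, together with its two endpoints. Paths are the monomials of the path
algebra. -/
structure QPath (V : Type u₁) [Quiver.{u₂} V] where
  src : V
  tgt : V
  path : Quiver.Path src tgt

namespace QPath

variable {V : Type u₁} [Quiver.{u₂} V]

/-- The length of a path, i.e. the degree of the monomial. -/
def length (p : QPath V) : ℕ := p.path.length

/-- The trivial path at a vertex. -/
def idem (v : V) : QPath V := ⟨v, v, Quiver.Path.nil⟩

open Classical in
/-- The product (concatenation) of two paths; `none` stands for the product `0`. -/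
def mul (p q : QPath V) : Option (QPath V) :=
  if h : p.tgt = q.src then
    some ⟨p.src, q.tgt, p.path.comp (Quiver.Path.cast h.symm rfl q.path)⟩
  else none

theorem mul_mk {a b c : V} (p : Quiver.Path a b) (q : Quiver.Path b c) :
    mul ⟨a, b, p⟩ ⟨b, c, q⟩ = some ⟨a, c, p.comp q⟩ := by
  simp [mul]

theorem mul_of_ne {p q : QPath V} (h : p.tgt ≠ q.src) : mul p q = none := by
  simp [mul, h]

theorem mul_tgt {p q d : QPath V} (h : mul p q = some d) : d.src = p.src ∧ d.tgt = q.tgt := by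
  unfold mul at h
  split_ifs at h
  cases h
  exact ⟨rfl, rfl⟩

theorem mul_assoc (p q s : QPath V) :
    (mul p q).bind (fun d => mul d s) = (mul q s).bind (fun d => mul p d) := by
  obtain ⟨a, b, p⟩ := p
  obtain ⟨b', c, q⟩ := q
  obtain ⟨c', e, s⟩ := s
  by_cases h1 : b = b'
  · subst h1
    by_cases h2 : c = c'
    · subst h2
      simp [mul_mk, Quiver.Path.comp_assoc]
    · have h3 : mul (⟨b, c, q⟩ : QPath V) ⟨c', e, s⟩ = none := mul_of_ne h2
      rw [h3, mul_mk]
      simpa using mul_of_ne (p := (⟨a, c, p.comp q⟩ : QPath V)) (q := ⟨c', e, s⟩) h2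
  · have h3 : mul (⟨a, b, p⟩ : QPath V) ⟨b', c, q⟩ = none := mul_of_ne h1
    rw [h3]
    cases h4 : mul (⟨b', c, q⟩ : QPath V) ⟨c', e, s⟩ with
    | none => rfl
    | some d =>
      have h5 := mul_tgt h4
      simp only [Option.bind_none, Option.bind_some]
      exact (mul_of_ne (by rw [h5.1]; exact h1)).symm

theorem mul_idem (p : QPath V) : mul p (idem p.tgt) = some p := by
  obtain ⟨a, b, p⟩ := p
  simp [idem, mul_mk]

theorem idem_mul (p : QPath V) : mul (idem p.src) p = some p := by
  obtain ⟨a, b, p⟩ := p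
  simp [idem, mul_mk]

end QPath

/-- The path algebra `K Q`: the vector space with basis the paths of the quiver. -/
def PathAlgebra (K : Type u₃) (V : Type u₁) [Field K] [Quiver.{u₂} V] :=
  QPath V →₀ K

namespace PathAlgebra

variable {K : Type u₃} {V : Type u₁} [Field K] [Quiver.{u₂} V]

instance : AddCommGroup (PathAlgebra K V) := inferInstanceAs (AddCommGroup (QPath V →₀ K))
instance : Module K (PathAlgebra K V) := inferInstanceAs (Module K (QPath V →₀ K))

/-- The coefficients of an element of the path algebra. -/
def coeff (x : PathAlgebra K V) : QPath V →₀ K := x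

/-- A path, as an element of the path algebra. -/
def mon (p : QPath V) : PathAlgebra K V := Finsupp.single p (1 : K)

/-- The product of two paths, as an element of the path algebra. -/
def prod (p q : QPath V) : PathAlgebra K V := ((p.mul q).map mon).getD 0

/-- The linear extension of a map defined on paths. -/
def lift {W : Type*} [AddCommGroup W] [Module K W] (f : QPath V → W) :
    PathAlgebra K V →ₗ[K] W := Finsupp.linearCombination K f

@[simp] theorem lift_mon {W : Type*} [AddCommGroup W] [Module K W] (f : QPath V → W)
    (p : QPath V) : lift (K := K) f (mon p) = f p := by
  have h := Finsupp.linearCombination_single K (v := f) (1 : K) p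
  rw [one_smul] at h
  exact h

theorem lin_ext {W : Type*} [AddCommGroup W] [Module K W] {f g : PathAlgebra K V →ₗ[K] W}
    (h : ∀ p, f (mon p) = g (mon p)) : f = g := by
  refine Finsupp.lhom_ext' (M := K) (fun p => LinearMap.ext_ring ?_)
  exact h p

/-- The multiplication of the path algebra, as a bilinear map: the bilinear extension of the
concatenation of paths. -/
def lmul : PathAlgebra K V →ₗ[K] PathAlgebra K V →ₗ[K] PathAlgebra K V :=
  lift (fun p => lift (fun q => prod p q))

instance : Mul (PathAlgebra K V) := ⟨fun x y => lmul x y⟩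

theorem mul_def (x y : PathAlgebra K V) : x * y = lmul x y := rfl

theorem mon_mul_mon (p q : QPath V) : (mon p * mon q : PathAlgebra K V) = prod p q := by
  simp [mul_def, lmul]

theorem prod_of_some {p q d : QPath V} (h : p.mul q = some d) :
    (prod p q : PathAlgebra K V) = mon d := by
  simp [prod, h]

theorem prod_of_none {p q : QPath V} (h : p.mul q = none) :
    (prod p q : PathAlgebra K V) = 0 := by
  simp [prod, h]

instance [Fintype V] : One (PathAlgebra K V) := ⟨∑ v : V, mon (QPath.idem v)⟩

theorem one_def [Fintype V] : (1 : PathAlgebra K V) = ∑ v : V, mon (QPath.idem v) := rfl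

theorem induction {p : PathAlgebra K V → Prop} (x : PathAlgebra K V) (h0 : p 0)
    (ha : ∀ x y, p x → p y → p (x + y)) (hm : ∀ (a : K) (q : QPath V), p (a • mon q)) : p x := by
  refine Finsupp.induction_linear (motive := p) x h0 ha (fun q a => ?_)
  have h : (Finsupp.single q a : QPath V →₀ K) = a • Finsupp.single q (1 : K) := by
    rw [Finsupp.smul_single, smul_eq_mul, mul_one]
  rw [h]
  exact hm a q

theorem mon_mul_assoc (p q s : QPath V) :
    (mon p * mon q * mon s : PathAlgebra K V) = mon p * (mon q * mon s) := by
  have h := QPath.mul_assoc p q s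
  rw [mon_mul_mon, mon_mul_mon]
  cases h1 : p.mul q with
  | none =>
    rw [prod_of_none h1]
    cases h2 : q.mul s with
    | none => simp [prod_of_none h2, mul_def]
    | some d =>
      rw [h1, h2] at h
      rw [prod_of_some h2, mon_mul_mon, prod_of_none h.symm]
      simp [mul_def]
  | some e =>
    rw [prod_of_some h1, mon_mul_mon]
    cases h2 : q.mul s with
    | none =>
      rw [h1, h2] at h
      rw [prod_of_none h2, prod_of_none h]
      simp [mul_def]
    | some d =>
      rw [h1, h2] at h
      rw [prod_of_some h2, mon_mul_mon]
      simp only [Option.bind_some] at h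
      simp only [prod, h]

instance : NonUnitalNonAssocRing (PathAlgebra K V) where
  __ := (inferInstance : AddCommGroup (PathAlgebra K V))
  left_distrib x y z := by simp [mul_def]
  right_distrib x y z := by simp [mul_def]
  zero_mul x := by simp [mul_def]
  mul_zero x := by simp [mul_def]

theorem smul_mul' (a : K) (x y : PathAlgebra K V) : a • x * y = a • (x * y) := by
  simp [mul_def]

theorem mul_smul' (a : K) (x y : PathAlgebra K V) : x * a • y = a • (x * y) := by
  simp [mul_def]

instance [Fintype V] : Ring (PathAlgebra K V) where
  __ := (inferInstance : NonUnitalNonAssocRing (PathAlgebra K V))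
  mul_assoc x y z := by
    induction x using induction with
    | h0 => simp
    | ha x x' h h' => simp only [add_mul, h, h']
    | hm a p =>
      induction y using induction with
      | h0 => simp
      | ha y y' h h' => simp only [add_mul, mul_add, h, h']
      | hm b q =>
        induction z using induction with
        | h0 => simp
        | ha z z' h h' => simp only [mul_add, h, h']
        | hm c s => simp only [smul_mul', mul_smul', mon_mul_assoc]
  one_mul x := by
    induction x using induction with
    | h0 => simp
    | ha x x' h h' => rw [mul_add, h, h']
    | hm a p =>
      rw [mul_smul', one_def, Finset.sum_mul, Finset.sum_eq_single p.src]
      · rw [mon_mul_mon, prod_of_some (QPath.idem_mul p)]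
      · intro v _ hv
        rw [mon_mul_mon, prod_of_none (QPath.mul_of_ne hv)]
      · simp
  mul_one x := by
    induction x using induction with
    | h0 => simp
    | ha x x' h h' => rw [add_mul, h, h']
    | hm a p =>
      rw [smul_mul', one_def, Finset.mul_sum, Finset.sum_eq_single p.tgt]
      · rw [mon_mul_mon, prod_of_some (QPath.mul_idem p)]
      · intro v _ hv
        rw [mon_mul_mon, prod_of_none (QPath.mul_of_ne (fun h => hv h.symm))]
      · simp

instance [Fintype V] : Algebra K (PathAlgebra K V) :=
  Algebra.ofModule smul_mul' (fun a x y => mul_smul' a x y)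

end PathAlgebra

/-! ### Leading terms and monomial orderings -/

/-- Let `v` be a family of vectors of `W`, indexed by a set with a strict order `lt`. The relation
`HasLT v lt f μ α` says: `f` is a linear combination of members of the family in which `v μ` occurs
with coefficient `α ≠ 0`, and all other members that occur have an index smaller than `μ`. When the
family is a basis, `v μ` is the leading monomial and `α` the leading coefficient of `f`. -/
def HasLT {K ι W : Type*} [Field K] [AddCommGroup W] [Module K W] (v : ι → W)
    (lt : ι → ι → Prop) (f : W) (μ : ι) (α : K) : Prop :=
  ∃ φ : ι →₀ K, Finsupp.linearCombination K v φ = f ∧ φ μ = α ∧ α ≠ 0 ∧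
    ∀ ν ∈ φ.support, ν ≠ μ → lt ν μ

/-- A monomial ordering of the path algebra. `lt p q` means `p < q`. -/
structure PathOrder (V : Type u₁) [Quiver.{u₂} V] where
  lt : QPath V → QPath V → Prop
  total : IsStrictTotalOrder (QPath V) lt
  mul_right : ∀ b₁ b₂ b d₁ d₂ : QPath V, lt b₂ b₁ →
    b₁.mul b = some d₁ → b₂.mul b = some d₂ → lt d₂ d₁
  mul_left : ∀ b₁ b₂ b d₁ d₂ : QPath V, lt b₂ b₁ →
    b.mul b₁ = some d₁ → b.mul b₂ = some d₂ → lt d₂ d₁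

/-- A monomial of the free right module `P ^ m` over the path algebra `P`: `(i, p)` stands for
`𝔢ᵢ · p`. Signatures are such monomials. -/
abbrev Sig (V : Type u₁) [Quiver.{u₂} V] (m : ℕ) := Fin m × QPath V

/-- The product of a monomial of `P ^ m` with a path; `none` stands for the product `0`. -/
def Sig.mul {V : Type u₁} [Quiver.{u₂} V] {m : ℕ} (s : Sig V m) (c : QPath V) :
    Option (Sig V m) :=
  (QPath.mul s.2 c).map (fun d => (s.1, d))

/-- A monomial ordering on `P ^ m` compatible with the given monomial ordering of `P`. -/
structure SigOrder {V : Type u₁} [Quiver.{u₂} V] (o : PathOrder V) (m : ℕ) where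
  lt : Sig V m → Sig V m → Prop
  total : IsStrictTotalOrder (Sig V m) lt
  compat : ∀ (i : Fin m) (b₁ b₂ : QPath V), o.lt b₂ b₁ → lt (i, b₂) (i, b₁)
  mul_right : ∀ (s₁ s₂ t₁ t₂ : Sig V m) (b : QPath V), lt s₂ s₁ →
    s₁.mul b = some t₁ → s₂.mul b = some t₂ → lt t₂ t₁

section Quotient

variable {K : Type u₃} {V : Type u₁} {A : Type u₄} [Field K] [Quiver.{u₂} V] [Fintype V]
  [Ring A] [Algebra K A]

/-- A path is a standard monomial of the quotient `ψ : P → A` if it is not the leading monomial of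
an element of the kernel of `ψ`. -/
def IsStd (ψ : PathAlgebra K V →ₐ[K] A) (o : PathOrder V) (p : QPath V) : Prop :=
  ¬ ∃ (k : PathAlgebra K V) (α : K), ψ k = 0 ∧ HasLT PathAlgebra.mon o.lt k p α

/-- The standard monomials. Since `ψ` is injective on them, they are used as names of the
monomials of `A` (the elements of the preferred basis `ψ (stdmon)`): the monomial of `A` named by
`b` is `ψ b`, and its lift `λ (ψ b)` is `b`. -/
def StdMon (ψ : PathAlgebra K V →ₐ[K] A) (o : PathOrder V) : Type (max u₁ u₂) :=
  {p : QPath V // IsStd ψ o p}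

variable {ψ : PathAlgebra K V →ₐ[K] A} {o : PathOrder V}

/-- The ordering of the monomials of `A`. -/
def StdMon.lt (b c : StdMon ψ o) : Prop := o.lt b.1 c.1

/-- The monomial of `A` named by a standard monomial. -/
def StdMon.val (b : StdMon ψ o) : A := ψ (PathAlgebra.mon b.1)

/-- `c` is a small cofactor of `b` with product `d`: the path `b c` is not `0` and is the standard
monomial `d`. -/
def SmallProd (b c d : StdMon ψ o) : Prop := QPath.mul b.1 c.1 = some d.1

/-- `c` is a small cofactor of `b`. -/
def SmallCofactor (b c : StdMon ψ o) : Prop := ∃ d, SmallProd b c d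

/-- `c` is the cofactor of a minimal toppling of `b`: it is not a small cofactor of `b`, but all
monomials that strictly divide `c` and differ from `c` are. -/
def MinTopplingCofactor (b c : StdMon ψ o) : Prop :=
  ¬ SmallCofactor b c ∧
    ∀ c' : StdMon ψ o, (∃ e : QPath V, QPath.mul c'.1 e = some c.1) → c' ≠ c → SmallCofactor b c'

variable (ψ o) in
/-- A monomial of the free right module `F = A ^ r`: `(i, b)` stands for `𝔳ᵢ · b`. -/
abbrev FMon (r : ℕ) := Fin r × StdMon ψ o

/-- The element `𝔳ᵢ · b` of `A ^ r`. -/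
def FMon.val {r : ℕ} (μ : FMon ψ o r) : Fin r → A := Pi.single μ.1 μ.2.val

variable (ψ o) in
/-- A monomial ordering on `F = A ^ r` compatible with the monomial ordering on `A`. -/
structure ModOrder (r : ℕ) where
  lt : FMon ψ o r → FMon ψ o r → Prop
  total : IsStrictTotalOrder (FMon ψ o r) lt
  compat : ∀ (i : Fin r) (b₁ b₂ : StdMon ψ o), b₂.lt b₁ → lt (i, b₂) (i, b₁)
  mul_right : ∀ (i j : Fin r) (b₁ b₂ b d t : StdMon ψ o) (α : K), lt (j, b₂) (i, b₁) →
    SmallProd b₁ b d → HasLT StdMon.val StdMon.lt (b₂.val * b.val) t α → lt (j, t) (i, d)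

/-- The right multiplication of `A ^ r`. -/
def rmul {r : ℕ} (f : Fin r → A) (a : A) : Fin r → A := fun i => f i * a

/-- `LeadTerm ω f μ α`: the leading monomial of `f ∈ A ^ r` is `μ`, its leading coefficient is
`α`. -/
def LeadTerm {r : ℕ} (ω : ModOrder ψ o r) (f : Fin r → A) (μ : FMon ψ o r) (α : K) : Prop :=
  HasLT FMon.val ω.lt f μ α

end Quotient

/-! ### The algorithm -/

/-- A pair of an (unsigned) element of `A ^ r` and a signature. -/
@[ext] structure SignedElt (V : Type u₁) [Quiver.{u₂} V] (A : Type u₄) (r m : ℕ) where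
  poly : Fin r → A
  sig : Sig V m

section Algorithm

variable {K : Type u₃} {V : Type u₁} {A : Type u₄} [Field K] [Quiver.{u₂} V] [Fintype V]
  [Ring A] [Algebra K A] {ψ : PathAlgebra K V →ₐ[K] A} {o : PathOrder V} {r m : ℕ}
  (ω : ModOrder ψ o r) (ε : SigOrder o m)

/-- `c` is a small cofactor of the leading monomial of `g`, with `LM(g) · c = LM(f)`. -/
def LeadDivides (g : Fin r → A) (c : StdMon ψ o) (f : Fin r → A) : Prop :=
  ∃ (i : Fin r) (b d : StdMon ψ o) (α β : K),
    LeadTerm ω g (i, b) α ∧ LeadTerm ω f (i, d) β ∧ SmallProd b c d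

/-- `f` is `s`-reducible with respect to `G`. -/
def Reducible (G : Finset (SignedElt V A r m)) (f : Fin r → A) (s : Sig V m) : Prop :=
  ∃ g ∈ G, ∃ (c : StdMon ψ o) (t : Sig V m),
    LeadDivides ω g.poly c f ∧ g.sig.mul c.1 = some t ∧ ε.lt t s

/-- One pass through the loop of the signed normal form algorithm: `f` is replaced by
`f - (LC(f) / LC(g)) g · c`. -/
def ReduceStep (G : Finset (SignedElt V A r m)) (s : Sig V m) (f f' : Fin r → A) : Prop :=
  ∃ g ∈ G, ∃ (i : Fin r) (b c d : StdMon ψ o) (α β : K) (t : Sig V m),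
    LeadTerm ω g.poly (i, b) α ∧ LeadTerm ω f (i, d) β ∧ SmallProd b c d ∧
    g.sig.mul c.1 = some t ∧ ε.lt t s ∧ f' = f - (β / α) • rmul g.poly c.val

/-- `g` may be discarded from `G`: for some other element `g'` of `G` and some small cofactor `c` of
`LM(g')` one has `LM(g') · c = LM(g)` and `σ(g') · λ(c) = σ(g)`. -/
def Redundant (G : Finset (SignedElt V A r m)) (g : SignedElt V A r m) : Prop :=
  ∃ g' ∈ G, g' ≠ g ∧ ∃ c : StdMon ψ o, LeadDivides ω g'.poly c g.poly ∧
    g'.sig.mul c.1 = some g.sig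

/-- `G` is interreduced. -/
def Interreduced (G : Finset (SignedElt V A r m)) : Prop :=
  ∀ g ∈ G, ¬ Reducible ω ε G g.poly g.sig ∧ ¬ Redundant ω G g

variable (ψ o) in
/-- The monomial `s` of `P ^ m` is standard relative to `L`. -/
def StdRelative (L : Finset (Sig V m)) (s : Sig V m) : Prop :=
  IsStd ψ o s.2 ∧
    ¬ ∃ c' b d e : QPath V, (s.1, c') ∈ L ∧ QPath.mul b c' = some e ∧ QPath.mul e d = some s.2

/-- `NormalPair ω ε G L f s`: the pair `(f, s)` is the S-polynomial of a critical pair of `G` that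
is normal relative to `L`. -/
inductive NormalPair (G : Finset (SignedElt V A r m)) (L : Finset (Sig V m)) :
    (Fin r → A) → Sig V m → Prop
  /-- a critical pair `(g, c)` of type T -/
  | typeT (g : SignedElt V A r m) (i : Fin r) (b c : StdMon ψ o) (α : K) (s : Sig V m) :
      g ∈ G → LeadTerm ω g.poly (i, b) α → MinTopplingCofactor b c →
      g.sig.mul c.1 = some s → StdRelative ψ o L s → ¬ Reducible ω ε G g.poly g.sig →
      NormalPair G L (rmul g.poly c.val) s
  /-- a critical pair `(g, g')` of type S with cofactor `c` -/
  | typeS (g g' : SignedElt V A r m) (i : Fin r) (b c d : StdMon ψ o) (α β : K) (s : Sig V m) :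
      g ∈ G → g' ∈ G → LeadTerm ω g.poly (i, b) α → LeadTerm ω g'.poly (i, d) β →
      SmallProd b c d → g.sig.mul c.1 = some s → ε.lt g'.sig s → StdRelative ψ o L s →
      ¬ Reducible ω ε G g.poly g.sig → ¬ Reducible ω ε G g'.poly g'.sig →
      NormalPair G L (rmul g.poly c.val - (α / β) • g'.poly) s

/-- There are `g ∈ G` and a small cofactor `c` of `LM(g)` such that `σ(g) · λ(c) = s` and `g · c` is
`s`-irreducible with respect to `G`. -/
def Covered (G : Finset (SignedElt V A r m)) (s : Sig V m) : Prop :=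
  ∃ g ∈ G, ∃ (i : Fin r) (b c : StdMon ψ o) (α : K),
    LeadTerm ω g.poly (i, b) α ∧ SmallCofactor b c ∧ g.sig.mul c.1 = some s ∧
    ¬ Reducible ω ε G (rmul g.poly c.val) s

/-- The states of the algorithm. -/
inductive State (V : Type u₁) [Quiver.{u₂} V] (A : Type u₄) (r m : ℕ)
  /-- `G` is being interreduced; the flag tells whether this happens in the initialisation. -/
  | interred (start : Bool) (G : Finset (SignedElt V A r m)) (L : Finset (Sig V m))
  /-- In the course of interreducing `G`, the normal form of `g ∈ G` with respect to `G \ {g}` is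
  being computed; `f` is the current remainder. -/
  | interredNF (start : Bool) (G : Finset (SignedElt V A r m)) (L : Finset (Sig V m))
      (g : SignedElt V A r m) (f : Fin r → A)
  /-- The head of the while-loop. -/
  | head (G : Finset (SignedElt V A r m)) (L : Finset (Sig V m))
  /-- The normal form of an S-polynomial of signature `s` with respect to `G` is being computed;
  `f` is the current remainder. -/
  | bodyNF (G : Finset (SignedElt V A r m)) (L : Finset (Sig V m)) (s : Sig V m) (f : Fin r → A)
  /-- The algorithm has returned `G`. -/
  | done (G : Finset (SignedElt V A r m))

open Classical in
/-- The elementary steps of the algorithm. All choices are left open. -/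
inductive Step : State V A r m → State V A r m → Prop
  /-- interreduction: choose a reducible element of `G` … -/
  | interredChoose (start : Bool) (G L) (g : SignedElt V A r m) :
      g ∈ G → Reducible ω ε (G.erase g) g.poly g.sig →
      Step (.interred start G L) (.interredNF start G L g g.poly)
  /-- … reduce it … -/
  | interredReduce (start : Bool) (G L) (g : SignedElt V A r m) (f f' : Fin r → A) :
      ReduceStep ω ε (G.erase g) g.sig f f' →
      Step (.interredNF start G L g f) (.interredNF start G L g f')
  /-- … discard it, and record its signature, if it reduces to zero … -/
  | interredZero (start : Bool) (G L) (g : SignedElt V A r m) :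
      Step (.interredNF start G L g 0) (.interred start (G.erase g) (insert g.sig L))
  /-- … and replace it by its normal form otherwise. -/
  | interredReplace (start : Bool) (G L) (g : SignedElt V A r m) (f : Fin r → A) :
      f ≠ 0 → ¬ Reducible ω ε (G.erase g) f g.sig →
      Step (.interredNF start G L g f) (.interred start (insert ⟨f, g.sig⟩ (G.erase g)) L)
  /-- interreduction: discard a redundant element. -/
  | interredDiscard (start : Bool) (G L) (g : SignedElt V A r m) :
      g ∈ G → Redundant ω G g →
      Step (.interred start G L) (.interred start (G.erase g) L)
  /-- The interreduction is finished; in the initialisation, `L` is then set to `∅`. -/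
  | interredExit (start : Bool) (G L) :
      Interreduced ω ε G →
      Step (.interred start G L) (.head G (if start then ∅ else L))
  /-- The body of the while-loop is entered with a critical pair that satisfies the condition. -/
  | enter (G L) (f : Fin r → A) (s : Sig V m) :
      NormalPair ω ε G L f s → ¬ Covered ω ε G s →
      Step (.head G L) (.bodyNF G L s f)
  /-- The S-polynomial is reduced. -/
  | reduce (G L) (s : Sig V m) (f f' : Fin r → A) :
      ReduceStep ω ε G s f f' →
      Step (.bodyNF G L s f) (.bodyNF G L s f')
  /-- The S-polynomial has been reduced to zero. -/
  | zero (G L) (s : Sig V m) :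
      Step (.bodyNF G L s 0) (.head G (insert s L))
  /-- The S-polynomial has a non-zero normal form. -/
  | nonzero (G L) (s : Sig V m) (f : Fin r → A) :
      f ≠ 0 → ¬ Reducible ω ε G f s →
      Step (.bodyNF G L s f) (.interred false (insert ⟨f, s⟩ G) L)
  /-- No critical pair satisfies the condition of the while-loop: return `G`. -/
  | finish (G L) :
      (∀ f s, NormalPair ω ε G L f s → Covered ω ε G s) →
      Step (.head G L) (.done G)

variable (ψ) in
open Classical in
/-- The non-zero ones among the pairs `(ĝᵢ · 1_v, 𝔢ᵢ · 1_v)`. Note that `𝔢ᵢ = ∑ᵥ 𝔢ᵢ · 1_v`, and that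
the monomials of `P ^ m` of degree zero are the `𝔢ᵢ · 1_v`. -/
def generatorPairs (ĝ : Fin m → Fin r → A) : Finset (SignedElt V A r m) :=
  ((Finset.univ : Finset (Fin m × V)).image (fun x =>
    (⟨rmul (ĝ x.1) (ψ (PathAlgebra.mon (QPath.idem x.2))), (x.1, QPath.idem x.2)⟩ :
      SignedElt V A r m))).filter (fun g => g.poly ≠ 0)

/-- The algorithm terminates on the input `ĝ₁, …, ĝₘ`, regardless of the choices made: there is no
infinite run, and each run that cannot be continued has returned a result. -/
def Terminates (ĝ : Fin m → Fin r → A) : Prop :=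
  let s₀ : State V A r m := .interred true (generatorPairs ψ ĝ) ∅
  Acc (fun t s => Step ω ε s t) s₀ ∧
    ∀ s, Relation.ReflTransGen (Step ω ε) s₀ s → (∀ t, ¬ Step ω ε s t) → ∃ G, s = .done G

end Algorithm

end F5

end

/-!
Since the standard monomials form a finite basis of the quotient, all elements of the free module
have a leading monomial among finitely many, and all signatures that the algorithm produces belong
to a finite set of standard signatures. The point is to find a measure that no interreduction can
spoil: interreducing replaces elements of `G`, and a cofactor that is small for the old leading
monomial need not be small for the new one.

For a signature `t`, let `attained ω G t` be the set of the leading monomials of the multiples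
`g · c` (`g ∈ G`, `c` a small cofactor of `LM(g)`) of signature `t`, and let `attainedBelow ω ε G s`
be the union of these sets for `t < s`. An element is `s`-reducible iff its leading monomial belongs
to `attainedBelow ω ε G s`. This set never shrinks (`attainedBelow_subset_erase`): if `g` is
replaced or deleted because some `g'` and `c'` reduce it, then each multiple `LM(g) · c` is also the
multiple `LM(g') · c' c`, whose signature is smaller than that of `g · c`. Removing redundant
elements does not even change the sets `attained ω G t` (`attained_subset_erase`).

Hence the sets `attainedBelow ω ε G s`, for the finitely many standard `s`, are eventually constant.
From then on an irreducible element stays irreducible, so that the number of reducible elements of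
`G` does not increase, and it drops with each replacement (`replace_measure`). An S-polynomial that
reduces to zero puts a new standard signature into `L`. If its normal form `f` is not zero, then
`LM(f)` has not been attained with the signature `s` of `f` before (`insert_measure`): an element
attaining it would be `s`-irreducible because `f` is, and `s` would be covered. Together with the
cardinality of `G`, the position in the program and the rank of the current remainder, this gives a
lexicographic measure that decreases in each step (`Step.measure_lt`).
-/

noncomputable section

namespace F5

/-! ### Leading terms with respect to a family of vectors -/

section LeadingTerms

variable {K ι W : Type*} [Field K] [AddCommGroup W] [Module K W] {v : ι → W}
  {lt : ι → ι → Prop}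

/-- The span of the members of the family `v` whose index is smaller than `μ`. -/
def below (K : Type*) {ι W : Type*} [Field K] [AddCommGroup W] [Module K W] (v : ι → W)
    (lt : ι → ι → Prop) (μ : ι) : Submodule K W :=
  Submodule.span K (v '' {ν | lt ν μ})

theorem mem_below {μ ν : ι} (h : lt ν μ) : v ν ∈ below K v lt μ :=
  Submodule.subset_span ⟨ν, h, rfl⟩

theorem below_mono [IsTrans ι lt] {μ ν : ι} (h : lt ν μ) :
    below K v lt ν ≤ below K v lt μ :=
  Submodule.span_mono (Set.image_mono fun _ hx => _root_.trans hx h)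

theorem hasLT_iff [Std.Irrefl lt] {f : W} {μ : ι} {α : K} :
    HasLT v lt f μ α ↔ α ≠ 0 ∧ f - α • v μ ∈ below K v lt μ := by
  classical
  constructor
  · rintro ⟨φ, rfl, rfl, h0, hlt⟩
    refine ⟨h0, ?_⟩
    rw [below, Finsupp.mem_span_image_iff_linearCombination]
    refine ⟨φ.erase μ, ?_, ?_⟩
    · rw [Finsupp.mem_supported]
      intro ν hν
      rw [Finset.mem_coe, Finsupp.support_erase, Finset.mem_erase] at hν
      exact hlt ν hν.2 hν.1
    · rw [eq_sub_iff_add_eq, ← Finsupp.linearCombination_single K (φ μ) μ, ← map_add,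
        Finsupp.erase_add_single]
  · rintro ⟨h0, h⟩
    rw [below, Finsupp.mem_span_image_iff_linearCombination] at h
    obtain ⟨l, hl, hlf⟩ := h
    rw [Finsupp.mem_supported] at hl
    have hμ : l μ = 0 := by
      by_contra hμ
      exact irrefl_of lt μ (hl (Finsupp.mem_support_iff.2 hμ))
    refine ⟨l + Finsupp.single μ α, ?_, by simp [hμ], h0, ?_⟩
    · rw [map_add, Finsupp.linearCombination_single, hlf, sub_add_cancel]
    · intro ν hν hne
      refine hl (Finsupp.mem_support_iff.2 ?_)
      have := Finsupp.mem_support_iff.1 hν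
      rwa [Finsupp.add_apply, Finsupp.single_eq_of_ne hne, add_zero] at this

theorem HasLT.mem_below_of_lt [IsStrictOrder ι lt] {f : W} {μ ν : ι} {α : K}
    (h : HasLT v lt f μ α) (hν : lt μ ν) : f ∈ below K v lt ν := by
  have h2 := (below_mono hν) (hasLT_iff.1 h).2
  have h3 := add_mem h2 ((below K v lt ν).smul_mem α (mem_below hν))
  rwa [sub_add_cancel] at h3

theorem HasLT.notMem_below [Std.Irrefl lt] (hv : LinearIndependent K v) {f : W} {μ : ι} {α : K}
    (h : HasLT v lt f μ α) : f ∉ below K v lt μ := by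
  intro hf
  obtain ⟨h0, h1⟩ := hasLT_iff.1 h
  have h2 : α • v μ ∈ below K v lt μ := by simpa using sub_mem hf h1
  rw [Submodule.smul_mem_iff _ h0] at h2
  exact hv.notMem_span_image (s := {ν | lt ν μ}) (irrefl_of lt μ) h2

theorem HasLT.index_unique [IsStrictTotalOrder ι lt] (hv : LinearIndependent K v) {f : W}
    {μ ν : ι} {α β : K} (h : HasLT v lt f μ α) (h' : HasLT v lt f ν β) : μ = ν := by
  rcases trichotomous_of lt μ ν with h1 | h1 | h1
  · exact absurd (h.mem_below_of_lt h1) (h'.notMem_below hv)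
  · exact h1
  · exact absurd (h'.mem_below_of_lt h1) (h.notMem_below hv)

theorem HasLT.ne_zero [Std.Irrefl lt] (hv : LinearIndependent K v) {f : W} {μ : ι} {α : K}
    (h : HasLT v lt f μ α) : f ≠ 0 := by
  rintro rfl
  exact h.notMem_below hv (zero_mem _)

theorem exists_max_of_nonempty [IsStrictTotalOrder ι lt] (s : Finset ι) (hs : s.Nonempty) :
    ∃ m ∈ s, ∀ x ∈ s, x ≠ m → lt x m := by
  induction hs using Finset.Nonempty.cons_induction with
  | singleton a =>
    exact ⟨a, by simp, fun x hx hne => absurd (Finset.mem_singleton.1 hx) hne⟩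
  | cons a s ha hs ih =>
    obtain ⟨m, hm, hmax⟩ := ih
    rcases trichotomous_of lt a m with h | h | h
    · refine ⟨m, Finset.mem_cons_of_mem hm, fun x hx hne => ?_⟩
      rcases Finset.mem_cons.1 hx with rfl | hx
      · exact h
      · exact hmax x hx hne
    · exact absurd (h ▸ hm) ha
    · refine ⟨a, Finset.mem_cons_self a s, fun x hx hne => ?_⟩
      rcases Finset.mem_cons.1 hx with rfl | hx
      · exact absurd rfl hne
      · by_cases hxm : x = m
        · exact hxm ▸ h
        · exact _root_.trans (hmax x hx hxm) h

theorem exists_hasLT [IsStrictTotalOrder ι lt] (hv : Submodule.span K (Set.range v) = ⊤) {f : W}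
    (hf : f ≠ 0) : ∃ (μ : ι) (α : K), HasLT v lt f μ α := by
  have h : f ∈ Submodule.span K (Set.range v) := hv ▸ Submodule.mem_top
  obtain ⟨φ, rfl⟩ := (Finsupp.mem_span_range_iff_exists_finsupp (R := K)).1 h
  have hφ : φ.support.Nonempty := by
    rw [Finsupp.support_nonempty_iff]
    rintro rfl
    simp at hf
  obtain ⟨μ, hμ, hmax⟩ := exists_max_of_nonempty (lt := lt) φ.support hφ
  exact ⟨μ, φ μ, φ, rfl, rfl, Finsupp.mem_support_iff.1 hμ, hmax⟩

end LeadingTerms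

/-! ### Paths -/

section Paths

variable {V : Type u₁} [Quiver.{u₂} V]

namespace QPath

theorem mul_eq_some_iff {p q d : QPath V} :
    p.mul q = some d ↔ ∃ (a b c : V) (p' : Quiver.Path a b) (q' : Quiver.Path b c),
      p = ⟨a, b, p'⟩ ∧ q = ⟨b, c, q'⟩ ∧ d = ⟨a, c, p'.comp q'⟩ := by
  constructor
  · intro h
    obtain ⟨a, b, p⟩ := p
    obtain ⟨b', c, q⟩ := q
    by_cases hb : b = b'
    · subst hb
      rw [mul_mk, Option.some_inj] at h
      exact ⟨a, b, c, p, q, rfl, rfl, h.symm⟩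
    · rw [mul_of_ne hb] at h
      cases h
  · rintro ⟨a, b, c, p', q', rfl, rfl, rfl⟩
    exact mul_mk p' q'

theorem tgt_eq_src {p q d : QPath V} (h : p.mul q = some d) : p.tgt = q.src := by
  obtain ⟨a, b, c, p', q', rfl, rfl, rfl⟩ := mul_eq_some_iff.1 h
  rfl

theorem exists_mul {p q : QPath V} (h : p.tgt = q.src) : ∃ d, p.mul q = some d := by
  obtain ⟨a, b, p⟩ := p
  obtain ⟨b', c, q⟩ := q
  obtain rfl : b = b' := h
  exact ⟨_, mul_mk p q⟩

theorem eq_idem_of_mul_eq_self {p q : QPath V} (h : p.mul q = some p) : q = idem p.tgt := by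
  obtain ⟨a, b, c, p', q', rfl, rfl, h3⟩ := mul_eq_some_iff.1 h
  obtain ⟨-, h4, h5⟩ := QPath.mk.inj h3
  subst h4
  have h6 := congrArg Quiver.Path.length (eq_of_heq h5)
  rw [Quiver.Path.length_comp] at h6
  have h7 := Quiver.Path.eq_nil_of_length_zero q' (by omega)
  subst h7
  rfl

/-- Two composable products may be bracketed the other way. -/
theorem mul_assoc_some {p q s d e : QPath V} (h : p.mul q = some d) (h' : d.mul s = some e) :
    ∃ x, q.mul s = some x ∧ p.mul x = some e := by
  have h1 := mul_assoc p q s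
  rw [h, Option.bind_some, h'] at h1
  exact Option.bind_eq_some_iff.1 h1.symm

/-- In a finite quiver there are only finitely many paths of bounded length. -/
theorem finite_length_lt [Finite V] [∀ a b : V, Finite (a ⟶ b)] (n : ℕ) :
    {p : QPath V | p.length < n}.Finite := by
  induction n with
  | zero => simp
  | succ n ih =>
    have h2 : (Set.range (idem : V → QPath V) ∪
        ⋃ p ∈ {p : QPath V | p.length < n}, ⋃ c : V,
          Set.range (fun e : p.tgt ⟶ c => (⟨p.src, c, p.path.cons e⟩ : QPath V))).Finite :=
      (Set.finite_range _).union (ih.biUnion fun p _ => Set.finite_iUnion fun c =>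
        Set.finite_range _)
    refine h2.subset ?_
    rintro ⟨a, b, p⟩ hp
    cases p with
    | nil => exact Or.inl ⟨a, rfl⟩
    | cons p e =>
      refine Or.inr (Set.mem_biUnion (x := ⟨a, _, p⟩) ?_ (Set.mem_iUnion.2 ⟨b, e, rfl⟩))
      have h3 : (p.cons e).length < n + 1 := hp
      rw [Quiver.Path.length_cons] at h3
      exact Nat.lt_of_succ_lt_succ h3

end QPath

namespace Sig

variable {m : ℕ}

theorem mul_eq_some_iff {s t : Sig V m} {c : QPath V} :
    s.mul c = some t ↔ s.1 = t.1 ∧ QPath.mul s.2 c = some t.2 := by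
  obtain ⟨i, p⟩ := s
  obtain ⟨j, q⟩ := t
  simp [Sig.mul]
  tauto

theorem mul_idem (s : Sig V m) : s.mul (QPath.idem s.2.tgt) = some s :=
  mul_eq_some_iff.2 ⟨rfl, QPath.mul_idem _⟩

theorem eq_of_mul_idem {s t : Sig V m} {v : V} (h : s.mul (QPath.idem v) = some t) : t = s := by
  have h1 : s.2.tgt = v := QPath.tgt_eq_src (mul_eq_some_iff.1 h).2
  rw [← h1, mul_idem, Option.some_inj] at h
  exact h.symm

theorem mul_assoc_some {s t u : Sig V m} {c d : QPath V} (h : s.mul c = some t)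
    (h' : t.mul d = some u) : ∃ x, c.mul d = some x ∧ s.mul x = some u := by
  rw [mul_eq_some_iff] at h h'
  obtain ⟨x, hx, hx'⟩ := QPath.mul_assoc_some h.2 h'.2
  exact ⟨x, hx, mul_eq_some_iff.2 ⟨h.1.trans h'.1, hx'⟩⟩

theorem tgt_eq_of_mul {s t : Sig V m} {c : QPath V} (h : s.mul c = some t) :
    t.2.tgt = c.tgt :=
  (QPath.mul_tgt (mul_eq_some_iff.1 h).2).2

end Sig

end Paths

/-! ### Standard monomials form a basis -/

section Basis

variable {K : Type u₃} {V : Type u₁} {A : Type u₄} [Field K] [Quiver.{u₂} V] [Fintype V]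
  [Ring A] [Algebra K A] {ψ : PathAlgebra K V →ₐ[K] A} {o : PathOrder V}

instance (o : PathOrder V) : IsStrictTotalOrder (QPath V) o.lt := o.total

instance : IsStrictTotalOrder (StdMon ψ o) StdMon.lt where
  irrefl a := irrefl_of o.lt a.1
  trans a b c h h' := trans_of o.lt h h'
  trichotomous a b h h' := by
    rcases trichotomous_of o.lt a.1 b.1 with h1 | h1 | h1
    · exact absurd h1 h
    · exact Subtype.ext h1
    · exact absurd h1 h'

theorem PathAlgebra.linearCombination_mon (φ : QPath V →₀ K) :
    Finsupp.linearCombination K (PathAlgebra.mon (K := K)) φ = φ := by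
  have h : Finsupp.linearCombination K (PathAlgebra.mon (K := K) (V := V)) =
      (LinearMap.id : (QPath V →₀ K) →ₗ[K] (QPath V →₀ K)) :=
    PathAlgebra.lin_ext (fun p => PathAlgebra.lift_mon _ p)
  exact congrArg (fun g => g φ) h

/-- Trivial paths are standard, because the kernel of `ψ` lives in degree at least `2`. -/
theorem isStd_idem (hquad : ∀ x : PathAlgebra K V, ψ x = 0 → ∀ p ∈ x.coeff.support, 2 ≤ p.length)
    (v : V) : IsStd ψ o (QPath.idem v) := by
  rintro ⟨k, α, hk, φ, rfl, hφ, h0, -⟩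
  rw [PathAlgebra.linearCombination_mon] at hk
  have h1 := hquad φ hk (QPath.idem v) (Finsupp.mem_support_iff.2 (hφ.symm ▸ h0 : φ _ ≠ 0))
  exact absurd h1 (by simp [QPath.idem, QPath.length])

/-- A terminal subpath of a standard path is standard. -/
theorem IsStd.of_mul_left {b e d : QPath V} (hd : IsStd ψ o d) (h : b.mul e = some d) :
    IsStd ψ o e := by
  rintro ⟨k, α, hk, hlt⟩
  refine hd ⟨PathAlgebra.mon b * k, α, by rw [map_mul, hk, mul_zero], ?_⟩
  rw [hasLT_iff] at hlt ⊢
  refine ⟨hlt.1, ?_⟩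
  have h1 : PathAlgebra.mon b * k - α • PathAlgebra.mon d =
      PathAlgebra.lmul (PathAlgebra.mon b) (k - α • PathAlgebra.mon e : PathAlgebra K V) := by
    rw [map_sub, map_smul, ← PathAlgebra.mul_def, ← PathAlgebra.mul_def, PathAlgebra.mon_mul_mon,
      PathAlgebra.prod_of_some h]
  rw [h1]
  refine (Submodule.span_le (p := (below K PathAlgebra.mon o.lt d).comap
    (PathAlgebra.lmul (PathAlgebra.mon b)))).2 ?_ hlt.2
  rintro _ ⟨ν, hν, rfl⟩
  rw [SetLike.mem_coe, Submodule.mem_comap, ← PathAlgebra.mul_def, PathAlgebra.mon_mul_mon]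
  cases h2 : b.mul ν with
  | none => rw [PathAlgebra.prod_of_none h2]; exact zero_mem _
  | some x =>
    rw [PathAlgebra.prod_of_some h2]
    exact mem_below (o.mul_left _ _ _ _ _ hν h h2)

theorem linearIndependent_stdMon :
    LinearIndependent K (StdMon.val : StdMon ψ o → A) := by
  rw [linearIndependent_iff]
  intro φ hφ
  by_contra h0
  obtain ⟨b, hb, hmax⟩ := exists_max_of_nonempty (lt := StdMon.lt) φ.support
    (Finsupp.support_nonempty_iff.2 h0)
  let k : PathAlgebra K V := Finsupp.linearCombination K
    (fun b : StdMon ψ o => (PathAlgebra.mon b.1 : PathAlgebra K V)) φ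
  have hk : ψ k = 0 := by
    have h1 := Finsupp.apply_linearCombination K ψ.toLinearMap
      (fun b : StdMon ψ o => (PathAlgebra.mon b.1 : PathAlgebra K V)) φ
    exact h1.trans hφ
  refine b.2 ⟨k, φ b, hk, φ.mapDomain (fun b : StdMon ψ o => b.1), ?_, ?_,
    Finsupp.mem_support_iff.1 hb, ?_⟩
  · rw [Finsupp.linearCombination_mapDomain]
    rfl
  · exact Finsupp.mapDomain_apply (f := fun b : StdMon ψ o => b.1) Subtype.val_injective _ _
  · classical
    intro ν hν hne
    obtain ⟨c, hc, rfl⟩ := Finset.mem_image.1 (Finsupp.mapDomain_support hν)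
    exact hmax c hc fun h => hne (congrArg _ h)

/-- If `ψ` vanishes on all paths outside of a set on which the path ordering is well-founded, then
the standard monomials span the quotient: a path that is not standard is congruent to a combination
of smaller paths. -/
theorem span_stdMon_of_wellFoundedOn (hψ : Function.Surjective ψ) (X : Set (QPath V))
    (hX : X.WellFoundedOn o.lt) (h0 : ∀ p ∉ X, ψ (PathAlgebra.mon p) = 0) :
    Submodule.span K (Set.range (StdMon.val : StdMon ψ o → A)) = ⊤ := by
  set S := Submodule.span K (Set.range (StdMon.val : StdMon ψ o → A)) with hS
  have key : ∀ p ∈ X, ψ (PathAlgebra.mon p) ∈ S := by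
    intro p hp
    refine hX.induction (P := fun p => ψ (PathAlgebra.mon p) ∈ S) hp (fun p hp ih => ?_)
    by_cases hstd : IsStd ψ o p
    · exact Submodule.subset_span ⟨⟨p, hstd⟩, rfl⟩
    · obtain ⟨k, α, hk, hlt⟩ := not_not.1 hstd
      obtain ⟨hα, hlt⟩ := hasLT_iff.1 hlt
      have h1 : k - α • PathAlgebra.mon p ∈ S.comap ψ.toLinearMap := by
        refine Submodule.span_le.2 ?_ hlt
        rintro _ ⟨ν, hν, rfl⟩
        by_cases hνX : ν ∈ X
        · exact ih ν hνX hν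
        · rw [SetLike.mem_coe, Submodule.mem_comap, AlgHom.toLinearMap_apply, h0 ν hνX]
          exact zero_mem _
      rw [Submodule.mem_comap, AlgHom.toLinearMap_apply, map_sub, hk, map_smul, zero_sub,
        neg_mem_iff, Submodule.smul_mem_iff _ hα] at h1
      exact h1
  rw [eq_top_iff]
  intro a _
  obtain ⟨x, rfl⟩ := hψ a
  induction x using PathAlgebra.induction with
  | h0 => rw [map_zero]; exact zero_mem _
  | ha x y hx hy => rw [map_add]; exact add_mem (hx trivial) (hy trivial)
  | hm a q =>
    rw [map_smul]
    refine S.smul_mem a ?_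
    by_cases hq : q ∈ X
    · exact key q hq
    · rw [h0 q hq]
      exact zero_mem _

theorem span_stdMon [∀ a b : V, Finite (a ⟶ b)] (hψ : Function.Surjective ψ)
    (hbasis : (∃ N : ℕ, ∀ p : QPath V, N ≤ p.length → ψ (PathAlgebra.mon p) = 0) ∨
      WellFounded o.lt ∨
      Submodule.span K (Set.range (StdMon.val : StdMon ψ o → A)) = ⊤) :
    Submodule.span K (Set.range (StdMon.val : StdMon ψ o → A)) = ⊤ := by
  rcases hbasis with ⟨N, hN⟩ | hwf | h
  · exact span_stdMon_of_wellFoundedOn hψ {p | p.length < N}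
      (QPath.finite_length_lt N).wellFoundedOn fun p hp => hN p (not_lt.1 hp)
  · exact span_stdMon_of_wellFoundedOn hψ Set.univ hwf.wellFoundedOn
      fun p hp => absurd trivial hp
  · exact h

variable {r : ℕ}

/-- The monomials of the free module form a basis if the monomials of the algebra do. -/
theorem exists_basis_fMon
    (hsp : Submodule.span K (Set.range (StdMon.val : StdMon ψ o → A)) = ⊤) :
    ∃ B : Module.Basis (FMon ψ o r) K (Fin r → A), ⇑B = FMon.val := by
  let b : Module.Basis (StdMon ψ o) K A := Module.Basis.mk linearIndependent_stdMon hsp.ge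
  refine ⟨(Pi.basis fun _ : Fin r => b).reindex (Equiv.sigmaEquivProd _ _), ?_⟩
  ext1 μ
  rw [Module.Basis.reindex_apply, Pi.basis_apply]
  simp [FMon.val, b]

theorem linearIndependent_fMon
    (hsp : Submodule.span K (Set.range (StdMon.val : StdMon ψ o → A)) = ⊤) :
    LinearIndependent K (FMon.val : FMon ψ o r → Fin r → A) := by
  obtain ⟨B, hB⟩ := exists_basis_fMon (r := r) hsp
  exact hB ▸ B.linearIndependent

theorem span_fMon
    (hsp : Submodule.span K (Set.range (StdMon.val : StdMon ψ o → A)) = ⊤) :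
    Submodule.span K (Set.range (FMon.val : FMon ψ o r → Fin r → A)) = ⊤ := by
  obtain ⟨B, hB⟩ := exists_basis_fMon (r := r) hsp
  exact hB ▸ B.span_eq

theorem finite_stdMon (hfin : FiniteDimensional K A) : Finite (StdMon ψ o) :=
  (linearIndependent_stdMon (ψ := ψ) (o := o)).finite

end Basis

/-! ### Leading terms in the free module -/

section FreeModule

variable {K : Type u₃} {V : Type u₁} {A : Type u₄} [Field K] [Quiver.{u₂} V] [Fintype V]
  [Ring A] [Algebra K A] {ψ : PathAlgebra K V →ₐ[K] A} {o : PathOrder V} {r m : ℕ}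

instance (ω : ModOrder ψ o r) : IsStrictTotalOrder (FMon ψ o r) ω.lt := ω.total

instance (ε : SigOrder o m) : IsStrictTotalOrder (Sig V m) ε.lt := ε.total

/-- Right multiplication by a fixed element, as a linear map. -/
def rmulLin (K : Type*) {A : Type*} [Field K] [Ring A] [Algebra K A] (r : ℕ) (a : A) :
    (Fin r → A) →ₗ[K] (Fin r → A) where
  toFun f := rmul f a
  map_add' f g := by ext i; simp [rmul, add_mul]
  map_smul' c f := by ext i; simp [rmul]

theorem rmulLin_apply (f : Fin r → A) (a : A) : rmulLin K r a f = rmul f a := rfl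

theorem rmul_rmul (f : Fin r → A) (a b : A) : rmul (rmul f a) b = rmul f (a * b) := by
  ext i
  simp [rmul, mul_assoc]

theorem rmul_fMon_val (μ : FMon ψ o r) (a : A) :
    rmul μ.val a = Pi.single μ.1 (μ.2.val * a) := by
  ext i
  by_cases h : i = μ.1
  · subst h; simp [rmul, FMon.val]
  · simp [rmul, FMon.val, h]

theorem SmallProd.val_mul {b c d : StdMon ψ o} (h : SmallProd b c d) :
    b.val * c.val = d.val := by
  rw [StdMon.val, StdMon.val, ← map_mul, PathAlgebra.mon_mul_mon, PathAlgebra.prod_of_some h]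
  rfl

theorem SmallProd.idem {b c : StdMon ψ o} (h : SmallProd b c b) : c.1 = QPath.idem b.1.tgt :=
  QPath.eq_idem_of_mul_eq_self h

/-- Small cofactors compose: a terminal subpath of a standard path is standard. -/
theorem SmallProd.assoc {b c d e f : StdMon ψ o} (h : SmallProd b c d) (h' : SmallProd d e f) :
    ∃ x : StdMon ψ o, QPath.mul c.1 e.1 = some x.1 ∧ SmallProd b x f := by
  obtain ⟨x, hx, hx'⟩ := QPath.mul_assoc_some h h'
  exact ⟨⟨x, f.2.of_mul_left hx'⟩, hx, hx'⟩

/-- Multiplication by a small cofactor is compatible with leading terms. -/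
theorem LeadTerm.rmul (ω : ModOrder ψ o r)
    (hsp : Submodule.span K (Set.range (StdMon.val : StdMon ψ o → A)) = ⊤)
    {f : Fin r → A} {i : Fin r} {b c d : StdMon ψ o} {α : K} (h : LeadTerm ω f (i, b) α)
    (hd : SmallProd b c d) : LeadTerm ω (rmul f c.val) (i, d) α := by
  obtain ⟨h0, hlt⟩ := hasLT_iff.1 h
  refine hasLT_iff.2 ⟨h0, ?_⟩
  have h1 : F5.rmul f c.val - α • FMon.val (i, d) =
      rmulLin K r c.val (f - α • FMon.val (i, b)) := by
    rw [map_sub, map_smul, rmulLin_apply, rmulLin_apply, rmul_fMon_val, hd.val_mul]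
    rfl
  rw [h1]
  refine (Submodule.span_le (p := (below K FMon.val ω.lt (i, d)).comap
    (rmulLin K r c.val))).2 ?_ hlt
  rintro _ ⟨⟨j, b₂⟩, hν, rfl⟩
  rw [SetLike.mem_coe, Submodule.mem_comap, rmulLin_apply, rmul_fMon_val]
  by_cases hz : b₂.val * c.val = 0
  · simp only [hz, Pi.single_zero]
    exact zero_mem _
  -- All monomials of `b₂ c` are at most its leading monomial, which `ω.mul_right` controls.
  obtain ⟨t, β, φ, hφ, hβ, hβ0, hmax⟩ := exists_hasLT (lt := StdMon.lt) hsp hz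
  have ht : ω.lt (j, t) (i, d) :=
    ω.mul_right i j b b₂ c d t β hν hd ⟨φ, hφ, hβ, hβ0, hmax⟩
  have h2 : Pi.single j (b₂.val * c.val) =
      Finsupp.linearCombination K (fun x : StdMon ψ o => FMon.val ((j, x) : FMon ψ o r)) φ := by
    rw [← hφ]
    exact Finsupp.apply_linearCombination K (LinearMap.single K (fun _ : Fin r => A) j)
      StdMon.val φ
  rw [h2, Finsupp.linearCombination_apply]
  refine Submodule.sum_mem _ fun x hx => Submodule.smul_mem _ _ (mem_below ?_)
  by_cases hxt : x = t
  · exact hxt ▸ ht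
  · exact _root_.trans (ω.compat j t x (hmax x hx hxt)) ht

theorem LeadTerm.unique (ω : ModOrder ψ o r)
    (hsp : Submodule.span K (Set.range (StdMon.val : StdMon ψ o → A)) = ⊤)
    {f : Fin r → A} {μ ν : FMon ψ o r} {α β : K} (h : LeadTerm ω f μ α)
    (h' : LeadTerm ω f ν β) : μ = ν :=
  HasLT.index_unique (v := (FMon.val : FMon ψ o r → Fin r → A)) (lt := ω.lt)
    (linearIndependent_fMon (r := r) hsp) h h'

/-- The number of monomials that do not exceed the leading monomial of `f`. -/
def rank (ω : ModOrder ψ o r) (f : Fin r → A) : ℕ :=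
  {μ : FMon ψ o r | f ∉ below K FMon.val ω.lt μ}.ncard

theorem rank_sub_lt [Finite (StdMon ψ o)] (ω : ModOrder ψ o r)
    (hsp : Submodule.span K (Set.range (StdMon.val : StdMon ψ o → A)) = ⊤)
    {f g : Fin r → A} {μ : FMon ψ o r} {α β : K} (hf : LeadTerm ω f μ β)
    (hg : LeadTerm ω g μ α) : rank ω (f - (β / α) • g) < rank ω f := by
  have hli := linearIndependent_fMon (r := r) hsp
  have hmem : f - (β / α) • g ∈ below K FMon.val ω.lt μ := by
    obtain ⟨-, hf⟩ := hasLT_iff.1 hf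
    obtain ⟨hα, hg⟩ := hasLT_iff.1 hg
    have h := sub_mem hf (Submodule.smul_mem _ (β / α) hg)
    rw [smul_sub, smul_smul, div_mul_cancel₀ _ hα] at h
    convert h using 1
    abel
  refine Set.ncard_lt_ncard ⟨fun ν hν hfν => hν ?_, fun h => ?_⟩ (Set.toFinite _)
  · rcases trichotomous_of ω.lt μ ν with h | h | h
    · exact below_mono h hmem
    · exact h ▸ hmem
    · exact absurd (below_mono h hfν) (hf.notMem_below hli)
  · exact h (a := μ) (hf.notMem_below hli) hmem

/-- `f` is homogeneous with end point `v`: all paths that occur in `f` end at `v`. -/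
def EndsAt (ψ : PathAlgebra K V →ₐ[K] A) (f : Fin r → A) (v : V) : Prop :=
  rmul f (ψ (PathAlgebra.mon (QPath.idem v))) = f

theorem EndsAt.sub_smul {f g : Fin r → A} {v : V} (hf : EndsAt ψ f v) (hg : EndsAt ψ g v)
    (a : K) : EndsAt ψ (f - a • g) v := by
  unfold EndsAt at *
  rw [← rmulLin_apply (K := K)] at *
  rw [map_sub, map_smul, hf, hg]

theorem endsAt_rmul (f : Fin r → A) (c : StdMon ψ o) : EndsAt ψ (rmul f c.val) c.1.tgt := by
  rw [EndsAt, rmul_rmul, StdMon.val, ← map_mul, PathAlgebra.mon_mul_mon,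
    PathAlgebra.prod_of_some (QPath.mul_idem _)]

theorem EndsAt.tgt_eq (ω : ModOrder ψ o r)
    (hsp : Submodule.span K (Set.range (StdMon.val : StdMon ψ o → A)) = ⊤)
    (hid : ∀ v, IsStd ψ o (QPath.idem v)) {f : Fin r → A} {v : V} (hf : EndsAt ψ f v)
    {i : Fin r} {d : StdMon ψ o} {α : K} (h : LeadTerm ω f (i, d) α) : d.1.tgt = v := by
  by_contra hne
  -- Otherwise `f = f · 1_v` is annihilated by the idempotent at the end point of `d`.
  have h1 := LeadTerm.rmul ω hsp h (c := ⟨QPath.idem d.1.tgt, hid _⟩) (QPath.mul_idem d.1)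
  refine HasLT.ne_zero (v := (FMon.val : FMon ψ o r → Fin r → A)) (lt := ω.lt)
    (linearIndependent_fMon (r := r) hsp) h1 ?_
  have hmul :
      ψ (PathAlgebra.mon (QPath.idem v)) * ψ (PathAlgebra.mon (QPath.idem d.1.tgt)) = 0 := by
    rw [← map_mul, PathAlgebra.mon_mul_mon,
      PathAlgebra.prod_of_none (QPath.mul_of_ne (fun h => hne h.symm)), map_zero]
  change F5.rmul f (ψ (PathAlgebra.mon (QPath.idem d.1.tgt))) = 0
  rw [← hf, rmul_rmul, hmul]
  ext i
  simp [F5.rmul]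

end FreeModule

/-! ### Leading monomials attained with a given signature -/

section Attained

variable {K : Type u₃} {V : Type u₁} {A : Type u₄} [Field K] [Quiver.{u₂} V] [Fintype V]
  [Ring A] [Algebra K A] {ψ : PathAlgebra K V →ₐ[K] A} {o : PathOrder V} {r m : ℕ}
  (ω : ModOrder ψ o r) (ε : SigOrder o m)

/-- The leading monomials `LM(g) · c` of multiples of elements `g` of `G` by small cofactors `c`
with `σ(g) · λ(c) = t`. -/
def attained (G : Finset (SignedElt V A r m)) (t : Sig V m) : Set (FMon ψ o r) :=
  {μ | ∃ g ∈ G, ∃ (b c : StdMon ψ o) (α : K),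
    LeadTerm ω g.poly (μ.1, b) α ∧ SmallProd b c μ.2 ∧ g.sig.mul c.1 = some t}

/-- The monomials attained with a signature smaller than `s`. An element is `s`-reducible iff its
leading monomial belongs to this set. -/
def attainedBelow (G : Finset (SignedElt V A r m)) (s : Sig V m) : Set (FMon ψ o r) :=
  {μ | ∃ t, ε.lt t s ∧ μ ∈ attained ω G t}

variable {ω ε} {G G' : Finset (SignedElt V A r m)}

theorem reducible_iff {f : Fin r → A} {s : Sig V m} :
    Reducible ω ε G f s ↔ ∃ μ α, LeadTerm ω f μ α ∧ μ ∈ attainedBelow ω ε G s := by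
  constructor
  · rintro ⟨g, hg, c, t, ⟨i, b, d, α, β, hgl, hfl, hd⟩, hs, ht⟩
    exact ⟨(i, d), β, hfl, t, ht, g, hg, b, c, α, hgl, hd, hs⟩
  · rintro ⟨⟨i, d⟩, β, hfl, t, ht, g, hg, b, c, α, hgl, hd, hs⟩
    exact ⟨g, hg, c, t, ⟨i, b, d, α, β, hgl, hfl, hd⟩, hs, ht⟩

theorem LeadTerm.reducible_iff
    (hsp : Submodule.span K (Set.range (StdMon.val : StdMon ψ o → A)) = ⊤)
    {f : Fin r → A} {s : Sig V m} {μ : FMon ψ o r} {α : K} (h : LeadTerm ω f μ α) :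
    Reducible ω ε G f s ↔ μ ∈ attainedBelow ω ε G s := by
  rw [F5.reducible_iff]
  constructor
  · rintro ⟨ν, β, h', hν⟩
    exact h'.unique ω hsp h ▸ hν
  · exact fun hμ => ⟨μ, α, h, hμ⟩

theorem attained_mono (h : G ⊆ G') (t : Sig V m) : attained ω G t ⊆ attained ω G' t :=
  fun _ ⟨g, hg, x⟩ => ⟨g, h hg, x⟩

theorem attainedBelow_mono (h : ∀ t, attained ω G t ⊆ attained ω G' t) (s : Sig V m) :
    attainedBelow ω ε G s ⊆ attainedBelow ω ε G' s :=
  fun _ ⟨t, ht, x⟩ => ⟨t, ht, h t x⟩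

theorem Reducible.mono {s : Sig V m} (h : attainedBelow ω ε G s ⊆ attainedBelow ω ε G' s)
    {f : Fin r → A} (hf : Reducible ω ε G f s) : Reducible ω ε G' f s := by
  rw [reducible_iff] at hf ⊢
  obtain ⟨μ, α, hμ, h'⟩ := hf
  exact ⟨μ, α, hμ, h h'⟩

/-- Multiplying an attained monomial by a small cofactor. -/
theorem mul_mem_attained {i : Fin r} {b c d : StdMon ψ o} {t u : Sig V m}
    (h : (i, b) ∈ attained ω G t) (hd : SmallProd b c d) (hu : t.mul c.1 = some u) :
    (i, d) ∈ attained ω G u := by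
  obtain ⟨g, hg, b', c', α, hl, hb, ht⟩ := h
  obtain ⟨x, hx, hx'⟩ := hb.assoc hd
  obtain ⟨y, hy, hy'⟩ := Sig.mul_assoc_some ht hu
  obtain rfl : x.1 = y := Option.some_inj.1 (hx.symm.trans hy)
  exact ⟨g, hg, b', x, α, hl, hx', hy'⟩

theorem mul_mem_attainedBelow {i : Fin r} {b c d : StdMon ψ o} {t u : Sig V m}
    (h : (i, b) ∈ attainedBelow ω ε G t) (hd : SmallProd b c d) (hu : t.mul c.1 = some u) :
    (i, d) ∈ attainedBelow ω ε G u := by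
  obtain ⟨w, hw, g, hg, b', c', α, hl, hb, hs⟩ := h
  obtain ⟨y, hy⟩ : ∃ y, QPath.mul w.2 c.1 = some y := QPath.exists_mul (by
    rw [Sig.tgt_eq_of_mul hs, ← (QPath.mul_tgt hb).2]
    exact QPath.tgt_eq_src hd)
  have hwy : w.mul c.1 = some (w.1, y) := Sig.mul_eq_some_iff.2 ⟨rfl, hy⟩
  exact ⟨(w.1, y), ε.mul_right _ _ _ _ _ hw hu hwy,
    mul_mem_attained ⟨g, hg, b', c', α, hl, hb, hs⟩ hd hwy⟩

open Classical in
/-- Removing an element of `G` that is reducible with respect to the others does not affect which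
monomials are reducible: multiples of its leading monomial are also multiples, with a smaller
signature, of the leading monomial of its reductor. -/
theorem attainedBelow_subset_erase
    (hsp : Submodule.span K (Set.range (StdMon.val : StdMon ψ o → A)) = ⊤)
    {g : SignedElt V A r m} (h : Reducible ω ε (G.erase g) g.poly g.sig) (s : Sig V m) :
    attainedBelow ω ε G s ⊆ attainedBelow ω ε (G.erase g) s := by
  rintro ⟨i, d⟩ ⟨t, ht, g', hg', b, c, α, hl, hd, hs⟩
  by_cases hgg : g' = g
  · subst hgg
    obtain ⟨u, hu, hmem⟩ := mul_mem_attainedBelow ((hl.reducible_iff hsp).1 h) hd hs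
    exact ⟨u, _root_.trans hu ht, hmem⟩
  · exact ⟨t, ht, g', Finset.mem_erase.2 ⟨hgg, hg'⟩, b, c, α, hl, hd, hs⟩

open Classical in
/-- Removing a redundant element does not affect which monomials are attained. -/
theorem attained_subset_erase
    (hsp : Submodule.span K (Set.range (StdMon.val : StdMon ψ o → A)) = ⊤)
    {g : SignedElt V A r m} (h : Redundant ω G g) (t : Sig V m) :
    attained ω G t ⊆ attained ω (G.erase g) t := by
  rintro ⟨i, d⟩ ⟨g', hg', b, c, α, hl, hd, hs⟩
  by_cases hgg : g' = g
  · subst hgg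
    obtain ⟨g₀, hg₀, hne, c₀, ⟨i₀, b₀, d₀, α₀, β₀, hl₀, hl', hd₀⟩, hs₀⟩ := h
    obtain ⟨rfl, rfl⟩ := Prod.mk.inj (hl.unique ω hsp hl')
    have hb : (i, b) ∈ attained ω (G.erase g') g'.sig :=
      ⟨g₀, Finset.mem_erase.2 ⟨hne, hg₀⟩, b₀, c₀, α₀, hl₀, hd₀, hs₀⟩
    exact mul_mem_attained hb hd hs
  · exact ⟨g', Finset.mem_erase.2 ⟨hgg, hg'⟩, b, c, α, hl, hd, hs⟩

open Classical in
/-- No element reduces itself. -/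
theorem reducible_insert_self_iff
    (hsp : Submodule.span K (Set.range (StdMon.val : StdMon ψ o → A)) = ⊤)
    {g : SignedElt V A r m} :
    Reducible ω ε (insert g G) g.poly g.sig ↔ Reducible ω ε G g.poly g.sig := by
  refine ⟨?_, Reducible.mono (attainedBelow_mono (attained_mono (Finset.subset_insert _ _)) _)⟩
  rintro ⟨g', hg', c, t, hdiv, hs, ht⟩
  rcases Finset.mem_insert.1 hg' with rfl | hg'
  · obtain ⟨i, b, d, α, β, hl, hl', hd⟩ := hdiv
    obtain ⟨-, rfl⟩ := Prod.mk.inj (hl.unique ω hsp hl')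
    obtain rfl : t = g'.sig := Sig.eq_of_mul_idem (hd.idem ▸ hs)
    exact absurd ht (irrefl_of ε.lt _)
  · exact ⟨g', hg', c, t, hdiv, hs, ht⟩

open Classical in
theorem reducible_erase_self_iff
    (hsp : Submodule.span K (Set.range (StdMon.val : StdMon ψ o → A)) = ⊤)
    {g : SignedElt V A r m} (hg : g ∈ G) :
    Reducible ω ε (G.erase g) g.poly g.sig ↔ Reducible ω ε G g.poly g.sig := by
  conv_rhs => rw [← Finset.insert_erase hg]
  exact (reducible_insert_self_iff hsp).symm

end Attained

section Termination

variable {K : Type u₃} {V : Type u₁} {A : Type u₄} [Field K] [Quiver.{u₂} V] [Fintype V]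
  [Ring A] [Algebra K A] {ψ : PathAlgebra K V →ₐ[K] A} {o : PathOrder V} {r m : ℕ}
  {ω : ModOrder ψ o r} {ε : SigOrder o m} {G G' : Finset (SignedElt V A r m)}

/-! ### Reduction steps -/

theorem ReduceStep.rank_lt [Finite (StdMon ψ o)]
    (hsp : Submodule.span K (Set.range (StdMon.val : StdMon ψ o → A)) = ⊤)
    {s : Sig V m} {f f' : Fin r → A} (h : ReduceStep ω ε G s f f') : rank ω f' < rank ω f := by
  obtain ⟨g, -, i, b, c, d, α, β, t, hg, hf, hd, -, -, rfl⟩ := h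
  exact rank_sub_lt ω hsp hf (hg.rmul ω hsp hd)

theorem ReduceStep.endsAt
    (hsp : Submodule.span K (Set.range (StdMon.val : StdMon ψ o → A)) = ⊤)
    (hid : ∀ v, IsStd ψ o (QPath.idem v)) {s : Sig V m} {f f' : Fin r → A} {v : V}
    (h : ReduceStep ω ε G s f f') (hv : EndsAt ψ f v) : EndsAt ψ f' v := by
  obtain ⟨g, -, i, b, c, d, α, β, t, hg, hf, hd, -, -, rfl⟩ := h
  have hc : c.1.tgt = v := (QPath.mul_tgt hd).2.symm.trans (hv.tgt_eq ω hsp hid hf)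
  exact hv.sub_smul (hc ▸ endsAt_rmul g.poly c) _

theorem Reducible.exists_reduceStep {s : Sig V m} {f : Fin r → A} (h : Reducible ω ε G f s) :
    ∃ f', ReduceStep ω ε G s f f' := by
  obtain ⟨g, hg, c, t, ⟨i, b, d, α, β, hgl, hfl, hd⟩, hs, ht⟩ := h
  exact ⟨_, g, hg, i, b, c, d, α, β, t, hgl, hfl, hd, hs, ht, rfl⟩

/-! ### Invariants of the algorithm -/

/-- All elements of `G` have a standard signature, and are homogeneous with the same end point as
their signature. -/
def Admissible (ψ : PathAlgebra K V →ₐ[K] A) (o : PathOrder V)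
    (G : Finset (SignedElt V A r m)) : Prop :=
  ∀ g ∈ G, IsStd ψ o g.sig.2 ∧ EndsAt ψ g.poly g.sig.2.tgt

variable (ω ε) in
open Classical in
/-- The invariant of the algorithm. While the normal form of `g` is computed, `g` is reducible;
while an S-polynomial of signature `s` is reduced, `s` is standard, not in `L` and not covered. -/
def Invariant : State V A r m → Prop
  | .interred _ G _ => Admissible ψ o G
  | .interredNF _ G _ g f => Admissible ψ o G ∧ g ∈ G ∧
      Reducible ω ε (G.erase g) g.poly g.sig ∧ EndsAt ψ f g.sig.2.tgt
  | .head G _ => Admissible ψ o G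
  | .bodyNF G L s f => Admissible ψ o G ∧ IsStd ψ o s.2 ∧ s ∉ L ∧ ¬ Covered ω ε G s ∧
      EndsAt ψ f s.2.tgt
  | .done _ => True

theorem Admissible.subset (h : Admissible ψ o G) (hs : G' ⊆ G) : Admissible ψ o G' :=
  fun g hg => h g (hs hg)

open Classical in
theorem Admissible.insert (h : Admissible ψ o G) {f : Fin r → A} {s : Sig V m}
    (hs : IsStd ψ o s.2) (hf : EndsAt ψ f s.2.tgt) : Admissible ψ o (insert ⟨f, s⟩ G) := by
  intro g hg
  rcases Finset.mem_insert.1 hg with rfl | hg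
  · exact ⟨hs, hf⟩
  · exact h g hg

theorem admissible_generatorPairs (hid : ∀ v, IsStd ψ o (QPath.idem v))
    (ĝ : Fin m → Fin r → A) : Admissible ψ o (generatorPairs ψ ĝ) := by
  classical
  intro g hg
  obtain ⟨x, -, rfl⟩ := Finset.mem_image.1 (Finset.mem_filter.1 hg).1
  exact ⟨hid _, endsAt_rmul (ĝ x.1) (⟨QPath.idem x.2, hid _⟩ : StdMon ψ o)⟩

theorem StdRelative.notMem {L : Finset (Sig V m)} {s : Sig V m} (h : StdRelative ψ o L s) :
    s ∉ L :=
  fun hs => h.2 ⟨s.2, QPath.idem s.2.src, QPath.idem s.2.tgt, s.2, hs, QPath.idem_mul _,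
    QPath.mul_idem _⟩

theorem NormalPair.stdRelative {L : Finset (Sig V m)} {f : Fin r → A} {s : Sig V m}
    (h : NormalPair ω ε G L f s) : StdRelative ψ o L s := by
  cases h <;> assumption

theorem NormalPair.endsAt
    (hsp : Submodule.span K (Set.range (StdMon.val : StdMon ψ o → A)) = ⊤)
    (hid : ∀ v, IsStd ψ o (QPath.idem v)) (hG : Admissible ψ o G) {L : Finset (Sig V m)}
    {f : Fin r → A} {s : Sig V m} (h : NormalPair ω ε G L f s) : EndsAt ψ f s.2.tgt := by
  cases h with
  | typeT g i b c α _ hg hl hc hs =>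
    rw [Sig.tgt_eq_of_mul hs]
    exact endsAt_rmul _ _
  | typeS g g' i b c d α β _ hg hg' hl hl' hd hs =>
    rw [Sig.tgt_eq_of_mul hs]
    refine (endsAt_rmul _ _).sub_smul ?_ _
    rw [← (QPath.mul_tgt hd).2, (hG g' hg').2.tgt_eq ω hsp hid hl']
    exact (hG g' hg').2

theorem Invariant.step
    (hsp : Submodule.span K (Set.range (StdMon.val : StdMon ψ o → A)) = ⊤)
    (hid : ∀ v, IsStd ψ o (QPath.idem v)) {s t : State V A r m} (hs : Invariant ω ε s)
    (h : Step ω ε s t) : Invariant ω ε t := by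
  classical
  cases h with
  | interredChoose start G L g hg hr => exact ⟨hs, hg, hr, (hs g hg).2⟩
  | interredReduce start G L g f f' hr =>
    obtain ⟨hG, hg, hgr, hf⟩ := hs
    exact ⟨hG, hg, hgr, hr.endsAt hsp hid hf⟩
  | interredZero start G L g => exact hs.1.subset (Finset.erase_subset _ _)
  | interredReplace start G L g f hf0 hfr =>
    obtain ⟨hG, hg, hgr, hf⟩ := hs
    exact (hG.subset (Finset.erase_subset _ _)).insert (hG g hg).1 hf
  | interredDiscard start G L g hg hr => exact Admissible.subset hs (Finset.erase_subset _ _)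
  | interredExit start G L hI => exact hs
  | enter G L f s hn hc =>
    exact ⟨hs, hn.stdRelative.1, hn.stdRelative.notMem, hc, hn.endsAt hsp hid hs⟩
  | reduce G L s f f' hr =>
    obtain ⟨hG, hstd, hL, hc, hf⟩ := hs
    exact ⟨hG, hstd, hL, hc, hr.endsAt hsp hid hf⟩
  | zero G L s => exact hs.1
  | nonzero G L s f hf0 hfr =>
    obtain ⟨hG, hstd, hL, hc, hf⟩ := hs
    exact hG.insert hstd hf
  | finish G L hc => trivial

/-! ### The termination measure -/

/-- A standard monomial of `P ^ m`, as a signature. -/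
def stdSig (x : Fin m × StdMon ψ o) : Sig V m := (x.1, x.2.1)

variable (ω ε) in
/-- The pairs of a standard signature `s` and a monomial that is not the leading monomial of an
`s`-reducible element. -/
def irreducibles (G : Finset (SignedElt V A r m)) :
    Set ((Fin m × StdMon ψ o) × FMon ψ o r) :=
  {x | x.2 ∉ attainedBelow ω ε G (stdSig x.1)}

variable (ω) in
/-- The pairs of a standard signature `s` and a monomial that is not attained with signature
`s`. -/
def unattained (G : Finset (SignedElt V A r m)) :
    Set ((Fin m × StdMon ψ o) × FMon ψ o r) :=
  {x | x.2 ∉ attained ω G (stdSig x.1)}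

variable (ω ε) in
/-- The elements of `G` that are reducible with respect to `G`. -/
def reducibles (G : Finset (SignedElt V A r m)) : Set (SignedElt V A r m) :=
  {g | g ∈ G ∧ Reducible ω ε G g.poly g.sig}

variable (ψ o) in
/-- The standard signatures that are not in `L`. -/
def unrecorded (L : Finset (Sig V m)) : Set (Fin m × StdMon ψ o) :=
  {x | stdSig x ∉ L}

/-- The values of the termination measure, ordered lexicographically. -/
abbrev Measure := ℕ ×ₗ ℕ ×ₗ ℕ ×ₗ ℕ ×ₗ ℕ ×ₗ ℕ ×ₗ ℕ ×ₗ ℕ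

variable (ω ε) in
/-- The termination measure of a state, given its start flag, the sets `G` and `L`, the position
in the program, and the rank of the current remainder. -/
def measureOf (start : Bool) (G : Finset (SignedElt V A r m)) (L : Finset (Sig V m))
    (phase rk : ℕ) : Measure :=
  toLex (start.toNat, toLex ((irreducibles ω ε G).ncard, toLex ((unrecorded ψ o L).ncard,
    toLex ((reducibles ω ε G).ncard, toLex ((unattained ω G).ncard, toLex (G.card,
      toLex (phase, rk)))))))

variable (ω ε) in
/-- The termination measure; it is smallest at the final states. The start flag is needed because `L` is emptied at the end of the
initialisation. -/
def stateMeasure : State V A r m → Measure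
  | .interred start G L => measureOf ω ε start G L 4 0
  | .interredNF start G L _ f => measureOf ω ε start G L 3 (rank ω f)
  | .head G L => measureOf ω ε false G L 2 0
  | .bodyNF G L _ f => measureOf ω ε false G L 1 (rank ω f)
  | .done _ => toLex (0, toLex (0, toLex (0, toLex (0, toLex (0, toLex (0, toLex (0, 0)))))))

theorem irreducibles_anti (h : ∀ s, attainedBelow ω ε G s ⊆ attainedBelow ω ε G' s) :
    irreducibles ω ε G' ⊆ irreducibles ω ε G :=
  fun _ hx hx' => hx (h _ hx')

theorem unattained_anti (h : ∀ s, attained ω G s ⊆ attained ω G' s) :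
    unattained ω G' ⊆ unattained ω G :=
  fun _ hx hx' => hx (h _ hx')

theorem finite_reducibles : (reducibles ω ε G).Finite :=
  G.finite_toSet.subset fun _ hg => hg.1

/-- If passing from `G` to `G'` does not change the first part of the measure, then it does not
change reducibility at standard signatures. -/
theorem reducible_of_ncard_eq [Finite (StdMon ψ o)]
    (h : ∀ s, attainedBelow ω ε G s ⊆ attainedBelow ω ε G' s)
    (hcard : (irreducibles ω ε G').ncard = (irreducibles ω ε G).ncard)
    {f : Fin r → A} {s : Sig V m} (hs : IsStd ψ o s.2) (hf : Reducible ω ε G' f s) :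
    Reducible ω ε G f s := by
  have heq := Set.eq_of_subset_of_ncard_le (irreducibles_anti h) hcard.ge (Set.toFinite _)
  refine hf.mono fun μ hμ => ?_
  by_contra hμ'
  have h1 : (((s.1, ⟨s.2, hs⟩) : Fin m × StdMon ψ o), μ) ∈ irreducibles ω ε G' := heq ▸ hμ'
  exact h1 hμ

open Classical in
/-- Deleting an element that is reducible with respect to the others, or replacing it by an
irreducible one, decreases the number of reducible elements unless more monomials become
reducible. -/
theorem replace_measure [Finite (StdMon ψ o)]
    (hsp : Submodule.span K (Set.range (StdMon.val : StdMon ψ o → A)) = ⊤)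
    (hG : Admissible ψ o G) {g : SignedElt V A r m} (hg : g ∈ G)
    (hr : Reducible ω ε (G.erase g) g.poly g.sig) (hsub : G.erase g ⊆ G')
    (hnew : ∀ g' ∈ G', g' ∈ G.erase g ∨ ¬ Reducible ω ε G' g'.poly g'.sig) :
    (irreducibles ω ε G').ncard ≤ (irreducibles ω ε G).ncard ∧
      ((irreducibles ω ε G').ncard = (irreducibles ω ε G).ncard →
        (reducibles ω ε G').ncard < (reducibles ω ε G).ncard) := by
  have hbelow : ∀ s, attainedBelow ω ε G s ⊆ attainedBelow ω ε G' s := fun s =>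
    (attainedBelow_subset_erase hsp hr s).trans (attainedBelow_mono (attained_mono hsub) s)
  refine ⟨Set.ncard_le_ncard (irreducibles_anti hbelow) (Set.toFinite _), fun hcard => ?_⟩
  have hle : ∀ g' ∈ reducibles ω ε G', g' ∈ (reducibles ω ε G) \ {g} := by
    rintro g' ⟨hg', hr'⟩
    rcases hnew g' hg' with h | h
    · obtain ⟨h1, h2⟩ := Finset.mem_erase.1 h
      exact ⟨⟨h2, reducible_of_ncard_eq hbelow hcard (hG g' h2).1 hr'⟩, h1⟩
    · exact absurd hr' h
  have hmem : g ∈ reducibles ω ε G := ⟨hg, (reducible_erase_self_iff hsp hg).1 hr⟩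
  exact Set.ncard_lt_ncard
    ⟨fun x hx => (hle x hx).1, fun h => (hle g (h hmem)).2 rfl⟩ finite_reducibles

open Classical in
/-- Removing a redundant element changes nothing but the cardinality of `G`, and possibly the
number of its reducible elements. -/
theorem discard_measure [Finite (StdMon ψ o)]
    (hsp : Submodule.span K (Set.range (StdMon.val : StdMon ψ o → A)) = ⊤)
    {g : SignedElt V A r m} (hg : g ∈ G) (hr : Redundant ω G g) :
    (irreducibles ω ε (G.erase g)).ncard ≤ (irreducibles ω ε G).ncard ∧
      (reducibles ω ε (G.erase g)).ncard ≤ (reducibles ω ε G).ncard ∧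
      (unattained ω (G.erase g)).ncard ≤ (unattained ω G).ncard ∧
      (G.erase g).card < G.card := by
  have hatt := attained_subset_erase hsp hr
  refine ⟨Set.ncard_le_ncard (irreducibles_anti (attainedBelow_mono hatt)) (Set.toFinite _),
    Set.ncard_le_ncard ?_ finite_reducibles,
    Set.ncard_le_ncard (unattained_anti hatt) (Set.toFinite _), Finset.card_erase_lt_of_mem hg⟩
  exact fun x hx => ⟨Finset.mem_of_mem_erase hx.1,
    hx.2.mono (attainedBelow_mono (attained_mono (Finset.erase_subset _ _)) _)⟩

open Classical in
/-- Adding a normal form of an S-polynomial whose signature `s` is not covered: its leading monomial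
has not been attained with signature `s` before, since the elements attaining it would be
`s`-irreducible. -/
theorem insert_measure [Finite (StdMon ψ o)]
    (hsp : Submodule.span K (Set.range (StdMon.val : StdMon ψ o → A)) = ⊤)
    (hid : ∀ v, IsStd ψ o (QPath.idem v)) (hG : Admissible ψ o G) {s : Sig V m}
    (hs : IsStd ψ o s.2) (hc : ¬ Covered ω ε G s) {f : Fin r → A} (hf : EndsAt ψ f s.2.tgt)
    (hf0 : f ≠ 0) (hr : ¬ Reducible ω ε G f s) :
    (irreducibles ω ε (insert ⟨f, s⟩ G)).ncard ≤ (irreducibles ω ε G).ncard ∧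
      ((irreducibles ω ε (insert ⟨f, s⟩ G)).ncard = (irreducibles ω ε G).ncard →
        (reducibles ω ε (insert ⟨f, s⟩ G)).ncard ≤ (reducibles ω ε G).ncard) ∧
      (unattained ω (insert ⟨f, s⟩ G)).ncard < (unattained ω G).ncard := by
  have hatt : ∀ t, attained ω G t ⊆ attained ω (insert ⟨f, s⟩ G) t :=
    attained_mono (Finset.subset_insert _ _)
  refine ⟨Set.ncard_le_ncard (irreducibles_anti (attainedBelow_mono hatt)) (Set.toFinite _),
    fun hcard => Set.ncard_le_ncard ?_ finite_reducibles,
    Set.ncard_lt_ncard ⟨unattained_anti hatt, fun hsub => ?_⟩ (Set.toFinite _)⟩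
  · rintro g ⟨hg, hgr⟩
    rcases Finset.mem_insert.1 hg with rfl | hg
    · exact absurd ((reducible_insert_self_iff hsp).1 hgr) hr
    · exact ⟨hg, reducible_of_ncard_eq (attainedBelow_mono hatt) hcard (hG g hg).1 hgr⟩
  · obtain ⟨⟨i, d⟩, α, hl⟩ := exists_hasLT (lt := ω.lt) (span_fMon (r := r) hsp) hf0
    have hold : (((s.1, ⟨s.2, hs⟩) : Fin m × StdMon ψ o), ((i, d) : FMon ψ o r)) ∈
        unattained ω G := by
      rintro ⟨g, hg, b, c, β, hgl, hd, hgs⟩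
      refine hc ⟨g, hg, i, b, c, β, hgl, ⟨d, hd⟩, hgs, fun hred => hr ?_⟩
      rw [LeadTerm.reducible_iff hsp (LeadTerm.rmul ω hsp hgl hd)] at hred
      exact (LeadTerm.reducible_iff hsp hl).2 hred
    refine hsub hold ⟨⟨f, s⟩, Finset.mem_insert_self _ _, d, ⟨QPath.idem d.1.tgt, hid _⟩, α, hl,
      QPath.mul_idem d.1, ?_⟩
    have htgt : d.1.tgt = s.2.tgt := hf.tgt_eq ω hsp hid hl
    simp only [htgt]
    exact Sig.mul_idem s

theorem unrecorded_insert_subset [DecidableEq (Sig V m)] (L : Finset (Sig V m)) (s : Sig V m) :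
    unrecorded ψ o (insert s L) ⊆ unrecorded ψ o L :=
  fun _ hx h => hx (Finset.mem_insert_of_mem h)

theorem Step.measure_lt [Finite (StdMon ψ o)]
    (hsp : Submodule.span K (Set.range (StdMon.val : StdMon ψ o → A)) = ⊤)
    (hid : ∀ v, IsStd ψ o (QPath.idem v)) {s t : State V A r m} (hs : Invariant ω ε s)
    (h : Step ω ε s t) : stateMeasure ω ε t < stateMeasure ω ε s := by
  classical
  cases h with
  | interredChoose start G L g hg hr =>
    simp [stateMeasure, measureOf, Prod.Lex.toLex_lt_toLex]
  | interredReduce start G L g f f' hr =>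
    have := hr.rank_lt hsp
    simp [stateMeasure, measureOf, Prod.Lex.toLex_lt_toLex, this]
  | interredZero start G L g =>
    obtain ⟨hG, hg, hgr, hf⟩ := hs
    have h1 := replace_measure hsp hG hg hgr subset_rfl fun g' hg' => Or.inl hg'
    have h2 := Set.ncard_le_ncard (unrecorded_insert_subset (ψ := ψ) (o := o) L g.sig)
      (Set.toFinite _)
    simp only [stateMeasure, measureOf, Prod.Lex.toLex_lt_toLex, true_and, lt_self_iff_false,
      false_or]
    omega
  | interredReplace start G L g f hf0 hfr =>
    obtain ⟨hG, hg, hgr, hf⟩ := hs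
    have h1 := replace_measure (G' := insert ⟨f, g.sig⟩ (G.erase g)) hsp hG hg hgr
      (Finset.subset_insert _ _) fun g' hg' => by
        rcases Finset.mem_insert.1 hg' with rfl | hg'
        · exact Or.inr (mt (reducible_insert_self_iff hsp).1 hfr)
        · exact Or.inl hg'
    simp only [stateMeasure, measureOf, Prod.Lex.toLex_lt_toLex, true_and, lt_self_iff_false,
      false_or]
    omega
  | interredDiscard start G L g hg hr =>
    have h1 := discard_measure (ε := ε) hsp hg hr
    simp only [stateMeasure, measureOf, Prod.Lex.toLex_lt_toLex, true_and, lt_self_iff_false,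
      false_or]
    omega
  | interredExit start G L hI =>
    cases start <;> simp [stateMeasure, measureOf, Prod.Lex.toLex_lt_toLex]
  | enter G L f s hn hc =>
    simp [stateMeasure, measureOf, Prod.Lex.toLex_lt_toLex]
  | reduce G L s f f' hr =>
    have := hr.rank_lt hsp
    simp [stateMeasure, measureOf, Prod.Lex.toLex_lt_toLex, this]
  | zero G L s =>
    obtain ⟨hG, hstd, hL, hc, hf⟩ := hs
    have h1 : (unrecorded ψ o (insert s L)).ncard < (unrecorded ψ o L).ncard :=
      Set.ncard_lt_ncard ⟨unrecorded_insert_subset L s, fun h =>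
        h (a := (s.1, ⟨s.2, hstd⟩)) hL (Finset.mem_insert_self _ _)⟩ (Set.toFinite _)
    simp only [stateMeasure, measureOf, Prod.Lex.toLex_lt_toLex, true_and, lt_self_iff_false,
      false_or]
    omega
  | nonzero G L s f hf0 hfr =>
    obtain ⟨hG, hstd, hL, hc, hf⟩ := hs
    have h1 := insert_measure hsp hid hG hstd hc hf hf0 hfr
    simp only [stateMeasure, measureOf, Prod.Lex.toLex_lt_toLex, true_and, lt_self_iff_false,
      false_or]
    omega
  | finish G L hc =>
    simp only [stateMeasure, measureOf, Prod.Lex.toLex_lt_toLex, lt_self_iff_false]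
    omega

theorem Invariant.acc [Finite (StdMon ψ o)]
    (hsp : Submodule.span K (Set.range (StdMon.val : StdMon ψ o → A)) = ⊤)
    (hid : ∀ v, IsStd ψ o (QPath.idem v)) (s : State V A r m) (hs : Invariant ω ε s) :
    Acc (fun t s => Step ω ε s t) s := by
  induction hμ : stateMeasure ω ε s using WellFoundedLT.induction generalizing s with
  | ind μ ih =>
    subst hμ
    exact ⟨s, fun t ht => ih _ (ht.measure_lt hsp hid hs) t (hs.step hsp hid ht) rfl⟩

/-! ### Progress -/

/-- A state in which no step is possible is a final one. -/
theorem exists_step_or_done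
    (hsp : Submodule.span K (Set.range (StdMon.val : StdMon ψ o → A)) = ⊤)
    (s : State V A r m) : (∃ t, Step ω ε s t) ∨ ∃ G, s = .done G := by
  classical
  cases s with
  | interred start G L =>
    left
    by_cases hI : Interreduced ω ε G
    · exact ⟨_, .interredExit start G L hI⟩
    · simp only [Interreduced, not_forall] at hI
      obtain ⟨g, hg, h⟩ := hI
      by_cases hred : Redundant ω G g
      · exact ⟨_, .interredDiscard start G L g hg hred⟩
      · have hr : Reducible ω ε G g.poly g.sig := by
          by_contra hr
          exact h ⟨hr, hred⟩
        exact ⟨_, .interredChoose start G L g hg ((reducible_erase_self_iff hsp hg).2 hr)⟩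
  | interredNF start G L g f =>
    left
    by_cases hf : f = 0
    · subst hf
      exact ⟨_, .interredZero start G L g⟩
    by_cases hr : Reducible ω ε (G.erase g) f g.sig
    · obtain ⟨f', h⟩ := hr.exists_reduceStep
      exact ⟨_, .interredReduce start G L g f f' h⟩
    · exact ⟨_, .interredReplace start G L g f hf hr⟩
  | head G L =>
    left
    by_cases h : ∀ f s, NormalPair ω ε G L f s → Covered ω ε G s
    · exact ⟨_, .finish G L h⟩
    · push Not at h
      obtain ⟨f, s, hn, hc⟩ := h
      exact ⟨_, .enter G L f s hn hc⟩
  | bodyNF G L s f =>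
    left
    by_cases hf : f = 0
    · subst hf
      exact ⟨_, .zero G L s⟩
    by_cases hr : Reducible ω ε G f s
    · obtain ⟨f', h⟩ := hr.exists_reduceStep
      exact ⟨_, .reduce G L s f f' h⟩
    · exact ⟨_, .nonzero G L s f hf hr⟩
  | done G => exact Or.inr ⟨G, rfl⟩

end Termination

end F5

end

theorem mainTheorem4 {K V A : Type*} [Field K] [Quiver V] [Fintype V]
    [∀ a b : V, Finite (a ⟶ b)] [Ring A] [Algebra K A]
    (ψ : F5.PathAlgebra K V →ₐ[K] A) (hψ : Function.Surjective ψ)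
    (hfin : FiniteDimensional K A)
    (hquad : ∀ x : F5.PathAlgebra K V, ψ x = 0 → ∀ p ∈ x.coeff.support, 2 ≤ p.length)
    (o : F5.PathOrder V)
    (hbasis : (∃ N : ℕ, ∀ p : F5.QPath V, N ≤ p.length → ψ (F5.PathAlgebra.mon p) = 0) ∨
      WellFounded o.lt ∨
      Submodule.span K (Set.range (F5.StdMon.val : F5.StdMon ψ o → A)) = ⊤)
    {r m : ℕ} (ω : F5.ModOrder ψ o r) (ε : F5.SigOrder o m) (ĝ : Fin m → Fin r → A) :
    F5.Terminates ω ε ĝ := by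
  have hsp := F5.span_stdMon hψ hbasis
  have hid : ∀ v, F5.IsStd ψ o (F5.QPath.idem v) := F5.isStd_idem hquad
  have : Finite (F5.StdMon ψ o) := F5.finite_stdMon hfin
  refine ⟨F5.Invariant.acc hsp hid _ (F5.admissible_generatorPairs hid ĝ), fun s _ hs => ?_⟩
  rcases F5.exists_step_or_done (ω := ω) (ε := ε) hsp s with ⟨t, ht⟩ | h
  · exact absurd ht (hs t)
  · exact h
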